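/- \textbf{Setting.} The target processor is a 32-bit PowerPC. Values are 32-bit integers, 64-bit IEEE floats, pointers $\mathtt{ptr}(b,\delta)$ and $\mathtt{undef}$. There are two types: $\mathtt{int}$ (size 4 bytes, inhabited by integers, pointers and $\mathtt{undef}$) and $\mathtt{float}$ (size 8 bytes, inhabited by floats and $\mathtt{undef}$). Memory is a collection of disjoint blocks with bounds, manipulated by $\mathtt{alloc}$, $\mathtt{free}$, $\mathtt{load}$, $\mathtt{store}$; $M\le M'$ (memory extension) means that every $\mathtt{load}$ that succeeds in $M$ succeeds in $M'$ with the same value. The observable behavior of a program is convergence with a finite trace of external calls and an exit code, divergence with a finite or infinite trace, or going wrong (being stuck in a non-final state) after a finite trace. $P\Downarrow B$ says that $B$ is a behavior of $P$. The entry point of a program takes no argument and returns an integer. \textbf{Linear.} A Linear function is a list of instructions over machine registers and the abstract stack slots $\mathtt{local}(\tau,\delta)$, $\mathtt{incoming}(\tau,\delta)$, $\mathtt{outgoing}(\tau,\delta)$: moves between slots and registers, operators, loads, stores, calls, tail calls, labels, jumps and return. Values of locations are held in a map; writing a slot sets overlapping slots to $\mathtt{undef}$. When a function is entered, its incoming slots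 take the values of its caller's outgoing slots, and its local and outgoing slots are undefined. When it returns, or performs a tail call, the callee-save registers and the local and incoming slots of its caller get the values they had before the call, and its caller's outgoing slots take the values of its incoming slots. The function's stack data are allocated in a memory block at entry and freed at return and at a tail call. \textbf{Mach.} In Mach, slots are replaced by $\mathtt{setstack}(r,\tau,\delta)$, $\mathtt{getstack}(\tau,\delta,r)$ and $\mathtt{getparent}(\tau,\delta,r)$, which address the activation record of the current function, and of its caller, at byte offset $\delta$ from the stack pointer. The record of a function $F$ is a memory block with bounds $[F.\mathtt{low},F.\mathtt{high})$; its frame part is $[F.\mathtt{low},0)$ and the stack pointer points to $F.\mathtt{low}$. Registers are global: nothing is saved or restored implicitly. In the \emph{standard semantics} frames live in memory: at function entry the block is allocated, and the caller's stack pointer and return address are stored at two offsets $F.\mathtt{link}$ and $F.\mathtt{retaddr}$; they are checked at return and at a tail call; stack instructions are memory loads and stores, and $\mathtt{getparent}$ goes through the link. Return addresses are given by a relation $\rho(F,c,\mathtt{ptr}(b,\delta))$ (the return address for a call in $F$ followed by the code $c$), on which the semantics is parameterized. We say that $Q$ \emph{has return addresses} if $\rho$ provides at least one for every $\mathtt{call}$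 instruction in the functions of $Q$. In the \emph{alternate semantics} frames are abstract maps from pairs (type, offset) to values (overlap-aware, initially $\mathtt{undef}$), kept in the state and not in memory; the memory block has bounds $[0,F.\mathtt{high})$; accesses are valid only inside the frame part and outside the two reserved places; $\mathtt{getparent}$ reads the abstract frame of the caller; there are no link and no return address. \textbf{Well-typedness.} A Linear or Mach program is well typed if each instruction of each function respects the $\mathtt{int}$/$\mathtt{float}$ types of registers, slots, operators, addressing modes and memory quantities. For Linear one requires moreover that incoming slots occurring in the code are stack parameters of the function and are never written, and that a tail call does not take its function pointer from a callee-save register and uses only stack arguments that are also stack parameters of the current function. For Mach one requires moreover $-2^{31}\le F.\mathtt{low}\le 0\le F.\mathtt{high}$ and that the 4-byte link and return-address places are disjoint and lie in the frame part. A state of the alternate Mach semantics is well typed if its functions and code are, and the values in its registers and abstract frames have the types of the registers and of the frame positions. \textbf{Translation.} For each function, the translation lays out an activation record which contains, from low to high addresses, the link (offset 0), the return address (offset 4), the outgoing arguments (from offset 8), the integer local slots, the saved integer callee-save registers, padding to a multiple of 8, the float local slots, the saved float callee-save registers, and the stack data of the function; each area is as large as the code of the function requires, and only the callee-save registers that occur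 in the code are saved. It fails if the frame part is larger than $2^{31}$ bytes. It translates local and outgoing slots to $\mathtt{setstack}$/$\mathtt{getstack}$ and incoming slots to $\mathtt{getparent}$ at the corresponding offsets, adds the size of the frame part to every offset into the stack data, saves the used callee-save registers at function entry, and restores them before each return and each tail call. Functions are translated one by one; external functions, global variables and the entry point are unchanged. \textbf{Theorem.} Let $\rho$ be any return-address relation. \begin{enumerate} \item[(A)] If $P$ is a well-typed Linear program whose translation succeeds and produces $Q$, and $Q$ has return addresses, then for every behavior $B$ that is not a going-wrong behavior, $P\Downarrow B$ implies $Q\Downarrow B$ in the standard Mach semantics. \item[(B)] If $P$ is a well-typed Linear program whose translation succeeds and produces $Q$, then $Q$ is well typed, and there is a relation between the states of $P$ and the states of $Q$ in the alternate semantics which is a ``plus'' simulation: if $P$ has an initial state, then so has $Q$; initial states are related; a state related to a final state is final with the same exit code; and each transition of $P$ with trace $t$ from a state related to $S_2$ is simulated by one or several transitions of $Q$ from $S_2$ with total trace $t$, leading to related states. Related states have the same memory and the same values of all registers. \item[(C)] (Subject reduction.) If $Q$ is a well-typed Mach program, then its initial states in the alternate semantics are well typed, and every transition of the alternate semantics from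 a well-typed state leads to a well-typed state. \item[(D)] If $Q$ is a well-typed Mach program that has return addresses, there is a relation between the states of $Q$ in the alternate semantics and the states of $Q$ in the standard semantics which is a lock-step simulation: the conditions on initial and final states are those of (B), and each transition of the alternate semantics with trace $t$ from a well-typed state related to $S_2$ is simulated by exactly one transition of the standard semantics from $S_2$ with trace $t$, leading to related states. Related states have the same register values, and memories $M\le M'$, where $M$ is that of the alternate and $M'$ that of the standard semantics. \end{enumerate} -/

import Mathlib

namespace Compcert

/-! ## Machine integers and IEEE binary64 floats -/

abbrev Int32b := BitVec 32

/-- A 64-bit IEEE double, given by its bit pattern. -/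
abbrev Float64 := BitVec 64

namespace Float64

def sign (f : Float64) : Bool := f.msb
def expo (f : Float64) : ℕ := f.toNat / 2 ^ 52 % 2 ^ 11
def mant (f : Float64) : ℕ := f.toNat % 2 ^ 52
def isNaN (f : Float64) : Bool := expo f == 2047 && mant f != 0
def isInf (f : Float64) : Bool := expo f == 2047 && mant f == 0

/-- The rational value of a finite float. -/
def toRat (f : Float64) : ℚ :=
  (if sign f then -1 else 1) *
    (if expo f = 0 then (mant f : ℚ) * (2 : ℚ) ^ (-1074 : ℤ)
     else ((2 ^ 52 + mant f : ℕ) : ℚ) * (2 : ℚ) ^ ((expo f : ℤ) - 1075))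

def ofParts (s : Bool) (bits : ℕ) : Float64 := BitVec.ofNat 64 ((if s then 2 ^ 63 else 0) + bits)

def nan : Float64 := ofParts false (2047 * 2 ^ 52 + 2 ^ 51)
def inf (s : Bool) : Float64 := ofParts s (2047 * 2 ^ 52)
def zero (s : Bool) : Float64 := ofParts s 0

/-- Rounding of a nonnegative rational to an integer, ties to even. -/
def roundEven (q : ℚ) : ℕ :=
  let m := ⌊q⌋₊
  let d := q - m
  if d < 1 / 2 then m else if 1 / 2 < d then m + 1 else if m % 2 = 0 then m else m + 1

/-- The double nearest to `q` (ties to even, gradual underflow, overflow to infinity);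
`s` is the sign of the result when `q = 0`. -/
def ofRat (s : Bool) (q : ℚ) : Float64 :=
  if q = 0 then zero s
  else
    let e := max (Int.log 2 |q|) (-1022)
    let m := roundEven (|q| / (2 : ℚ) ^ (e - 52))
    ofParts (decide (q < 0)) (min ((e + 1022).toNat * 2 ^ 52 + m) (2047 * 2 ^ 52))

def neg (f : Float64) : Float64 := f ^^^ BitVec.ofNat 64 (2 ^ 63)
def abs (f : Float64) : Float64 := f &&& BitVec.ofNat 64 (2 ^ 63 - 1)

def add (a b : Float64) : Float64 :=
  if isNaN a || isNaN b then nan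
  else if isInf a then (if isInf b && (sign a != sign b) then nan else a)
  else if isInf b then b
  else ofRat (sign a && sign b) (toRat a + toRat b)

def sub (a b : Float64) : Float64 := add a (neg b)

def isZero (a : Float64) : Bool := expo a == 0 && mant a == 0

def mul (a b : Float64) : Float64 :=
  let s := sign a ^^ sign b
  if isNaN a || isNaN b then nan
  else if isInf a then (if isZero b then nan else inf s)
  else if isInf b then (if isZero a then nan else inf s)
  else ofRat s (toRat a * toRat b)

def div (a b : Float64) : Float64 :=
  let s := sign a ^^ sign b
  if isNaN a || isNaN b then nan
  else if isInf a then (if isInf b then nan else inf s)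
  else if isInf b then zero s
  else if isZero b then (if isZero a then nan else inf s)
  else ofRat s (toRat a / toRat b)

/-- Rounding to single precision (the result is again represented as a double). -/
def single (f : Float64) : Float64 :=
  if isNaN f then nan
  else if isInf f || isZero f then f
  else
    let q := |toRat f|
    let e := max (Int.log 2 q) (-126)
    let v : ℚ := (roundEven (q / (2 : ℚ) ^ (e - 23)) : ℚ) * (2 : ℚ) ^ (e - 23)
    if (2 : ℚ) ^ (128 : ℤ) ≤ v then inf (sign f)
    else ofRat (sign f) (if sign f then -v else v)

/-- Position of a non-NaN float on the extended line (`±2^1024` stands for the infinities). -/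
def key (f : Float64) : ℚ :=
  if isInf f then (if sign f then -1 else 1) * (2 : ℚ) ^ (1024 : ℤ) else toRat f

/-- Truncation towards zero. -/
def trunc (f : Float64) : ℤ := if 0 ≤ toRat f then ⌊toRat f⌋ else ⌈toRat f⌉

/-- Conversion to a signed 32-bit integer, undefined if the truncated value is out of range. -/
def toInt (f : Float64) : Option Int32b :=
  if isNaN f || isInf f then none
  else if -(2 ^ 31) ≤ trunc f ∧ trunc f < 2 ^ 31 then some (BitVec.ofInt 32 (trunc f)) else none

/-- Conversion to an unsigned 32-bit integer, undefined if the truncated value is out of range. -/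
def toUInt (f : Float64) : Option Int32b :=
  if isNaN f || isInf f then none
  else if 0 ≤ trunc f ∧ trunc f < 2 ^ 32 then some (BitVec.ofInt 32 (trunc f)) else none

def ofInt (n : Int32b) : Float64 := ofRat false (n.toInt : ℚ)
def ofUInt (n : Int32b) : Float64 := ofRat false (n.toNat : ℚ)

end Float64

inductive Comparison
  | eq | ne | gt | ge | lt | le
  deriving DecidableEq

def cmpSigned (c : Comparison) (a b : Int32b) : Bool :=
  match c with
  | .eq => a == b | .ne => a != b
  | .gt => b.slt a | .ge => b.sle a | .lt => a.slt b | .le => a.sle b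

def cmpUnsigned (c : Comparison) (a b : Int32b) : Bool :=
  match c with
  | .eq => a == b | .ne => a != b
  | .gt => b.ult a | .ge => b.ule a | .lt => a.ult b | .le => a.ule b

/-- IEEE comparison: with a NaN operand only `ne` holds. -/
def cmpFloat (c : Comparison) (a b : Float64) : Bool :=
  if Float64.isNaN a || Float64.isNaN b then decide (c = .ne)
  else
    let x := Float64.key a
    let y := Float64.key b
    match c with
    | .eq => decide (x = y) | .ne => decide (x ≠ y)
    | .gt => decide (x > y) | .ge => decide (x ≥ y)
    | .lt => decide (x < y) | .le => decide (x ≤ y)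

/-! ## Types, values, signatures, programs -/

abbrev Ident := ℕ
abbrev Label := ℕ
/-- Block identifiers: positive for data blocks, negative for function blocks. -/
abbrev Block := ℤ

inductive Typ
  | int | float
  deriving DecidableEq

/-- Size in bytes. -/
def Typ.size : Typ → ℤ
  | .int => 4
  | .float => 8

/-- Size in 4-byte words. -/
def Typ.words : Typ → ℕ
  | .int => 1
  | .float => 2

inductive Val
  | int (n : Int32b)
  | float (f : Float64)
  | ptr (b : Block) (δ : Int32b)
  | undef
  deriving DecidableEq

/-- The judgement `v : τ`. -/
def Val.HasType : Val → Typ → Prop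
  | .int _, τ => τ = .int
  | .float _, τ => τ = .float
  | .ptr _ _, τ => τ = .int
  | .undef, _ => True

/-- Function signatures; `res = none` means `void`. -/
structure Sig where
  args : List Typ
  res : Option Typ
  deriving DecidableEq

/-- Signature of the program entry point: no arguments, integer exit code. -/
def mainSig : Sig := ⟨[], some .int⟩

/-- The register class in which a result is returned (integer for `void`). -/
def Sig.resTyp (s : Sig) : Typ := s.res.getD .int

structure ExtFun where
  tag : Ident
  sig : Sig

inductive FunDef (F : Type)
  | internal (f : F)
  | external (fe : ExtFun)

inductive InitData
  | reserve (n : ℕ)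
  | int8 (n : Int32b)
  | int16 (n : Int32b)
  | int32 (n : Int32b)
  | float32 (f : Float64)
  | float64 (f : Float64)

structure Program (F : Type) where
  vars : List (Ident × List InitData)
  functs : List (Ident × FunDef F)
  main : Ident

/-- Extension of a partial transformation of internal functions to whole programs; `none` is a
compile-time error. -/
def transfFunDef {F₁ F₂ : Type} (tr : F₁ → Option F₂) : FunDef F₁ → Option (FunDef F₂)
  | .internal f => (tr f).map .internal
  | .external fe => some (.external fe)

def transfProgram {F₁ F₂ : Type} (tr : F₁ → Option F₂) (P : Program F₁) :
    Option (Program F₂) :=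
  (P.functs.mapM fun d => (transfFunDef tr d.2).map fun fd => (d.1, fd)).map
    fun fs => ⟨P.vars, fs, P.main⟩

/-! ## Memory model -/

inductive Chunk
  | int8signed | int8unsigned | int16signed | int16unsigned | int32 | float32 | float64
  deriving DecidableEq

def Chunk.size : Chunk → ℕ
  | .int8signed | .int8unsigned => 1
  | .int16signed | .int16unsigned => 2
  | .int32 | .float32 => 4
  | .float64 => 8

def Chunk.typ : Chunk → Typ
  | .float32 | .float64 => .float
  | _ => .int

/-- The memory quantity `κ(τ)` that stores a value of type `τ` without losing information. -/
def Typ.chunk : Typ → Chunk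
  | .int => .int32
  | .float => .float64

/-- Truncation or extension of a value as prescribed by a memory quantity; `undef` if the value
does not fit the quantity. -/
def cast : Chunk → Val → Val
  | .int8signed, .int n => .int ((n.setWidth 8).signExtend 32)
  | .int8unsigned, .int n => .int ((n.setWidth 8).setWidth 32)
  | .int16signed, .int n => .int ((n.setWidth 16).signExtend 32)
  | .int16unsigned, .int n => .int ((n.setWidth 16).setWidth 32)
  | .int32, .int n => .int n
  | .int32, .ptr b δ => .ptr b δ
  | .float32, .float f => .float (Float64.single f)
  | .float64, .float f => .float f
  | _, _ => .undef

/-- Contents of one byte: uninitialized, first byte of a datum of `n` bytes holding `v`,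
or a later byte of a datum. -/
inductive Content
  | undef
  | datum (n : ℕ) (v : Val)
  | cont
  deriving DecidableEq

structure BlockData where
  lo : ℤ
  hi : ℤ
  contents : ℤ → Content

/-- Memory states. Blocks that were never allocated, or were freed, have empty bounds. -/
structure Mem where
  blocks : Block → BlockData
  next : Block

namespace Mem

def emptyBlock : BlockData := ⟨0, 0, fun _ => .undef⟩

def empty : Mem := ⟨fun _ => emptyBlock, 1⟩

def alloc (M : Mem) (l h : ℤ) : Block × Mem :=
  (M.next, ⟨Function.update M.blocks M.next ⟨l, h, fun _ => .undef⟩, M.next + 1⟩)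

def free (M : Mem) (b : Block) : Mem := ⟨Function.update M.blocks b emptyBlock, M.next⟩

def getN (c : ℤ → Content) (n : ℕ) (δ : ℤ) : Val :=
  match c δ with
  | .datum m v =>
      if m = n ∧ (List.range (n - 1)).all (fun i => c (δ + 1 + i) = .cont) then v else .undef
  | _ => .undef

def setN (c : ℤ → Content) (n : ℕ) (δ : ℤ) (v : Val) : ℤ → Content := fun x =>
  if x = δ then .datum n v else if δ < x ∧ x < δ + n then .cont else c x

def InBounds (M : Mem) (κ : Chunk) (b : Block) (δ : ℤ) : Prop :=
  (M.blocks b).lo ≤ δ ∧ δ + κ.size ≤ (M.blocks b).hi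

instance (M : Mem) (κ : Chunk) (b : Block) (δ : ℤ) : Decidable (M.InBounds κ b δ) := by
  unfold InBounds; infer_instance

def load (M : Mem) (κ : Chunk) (b : Block) (δ : ℤ) : Option Val :=
  if M.InBounds κ b δ then some (cast κ (getN (M.blocks b).contents κ.size δ)) else none

def store (M : Mem) (κ : Chunk) (b : Block) (δ : ℤ) (v : Val) : Option Mem :=
  if M.InBounds κ b δ then
    some ⟨Function.update M.blocks b
      { M.blocks b with contents := setN (M.blocks b).contents κ.size δ v }, M.next⟩
  else none

/-- The memory extension ordering `M ≤ M'`. -/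
def Extends (M M' : Mem) : Prop :=
  ∀ κ b δ v, M.load κ b δ = some v → M'.load κ b δ = some v

end Mem

/-! ## Global environments and initial memory -/

structure GEnv (F : Type) where
  funct : Block → Option (FunDef F)
  symbol : Ident → Option Block

/-- The `i`-th function (from 0) lives at block `-(i+1)`, the `j`-th variable at block `j+1`. -/
def globalenv {F : Type} (P : Program F) : GEnv F where
  funct b := if b < 0 then (P.functs[(-b - 1).toNat]?).map Prod.snd else none
  symbol id :=
    match P.functs.findIdx? (fun d => d.1 == id) with
    | some i => some (-((i : ℤ) + 1))
    | none => (P.vars.findIdx? (fun d => d.1 == id)).map fun j => (j : ℤ) + 1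

def InitData.size : InitData → ℕ
  | .reserve n => n
  | .int8 _ => 1
  | .int16 _ => 2
  | .int32 _ => 4
  | .float32 _ => 4
  | .float64 _ => 8

def InitData.storeAt (M : Mem) (b : Block) (δ : ℤ) : InitData → Mem
  | .reserve _ => M
  | .int8 n => (M.store .int8unsigned b δ (.int n)).getD M
  | .int16 n => (M.store .int16unsigned b δ (.int n)).getD M
  | .int32 n => (M.store .int32 b δ (.int n)).getD M
  | .float32 f => (M.store .float32 b δ (.float f)).getD M
  | .float64 f => (M.store .float64 b δ (.float f)).getD M

def storeInit (M : Mem) (b : Block) (δ : ℤ) : List InitData → Mem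
  | [] => M
  | d :: ds => storeInit (d.storeAt M b δ) b (δ + d.size) ds

def allocVar (M : Mem) (data : List InitData) : Mem :=
  let r := M.alloc 0 ((data.map InitData.size).sum : ℕ)
  storeInit r.2 r.1 0 data

/-- Allocates and initializes one data block per global variable, at blocks `1, 2, ...`. -/
def initmem {F : Type} (P : Program F) : Mem :=
  P.vars.foldl (fun M d => allocVar M d.2) Mem.empty

/-! ## Events, traces, behaviors, transition semantics -/

inductive EventVal
  | int (n : Int32b)
  | float (f : Float64)

def EventVal.toVal : EventVal → Val
  | .int n => .int n
  | .float f => .float f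

def EventVal.typ : EventVal → Typ
  | .int _ => .int
  | .float _ => .float

structure Event where
  tag : Ident
  args : List EventVal
  res : EventVal

/-- Finite traces. -/
abbrev Trace := List Event

/-- Finite or infinite traces. -/
abbrev InfTrace := Stream'.Seq Event

/-- The effect of an external function applied to `vs`, with trace `t` and result `v`. -/
def ExtCall (fe : ExtFun) (vs : List Val) (t : Trace) (v : Val) : Prop :=
  ∃ (es : List EventVal) (e : EventVal),
    vs = es.map EventVal.toVal ∧ v = e.toVal ∧
    es.map EventVal.typ = fe.sig.args ∧ e.typ = fe.sig.resTyp ∧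
    t = [⟨fe.tag, es, e⟩]

inductive Behavior
  | converges (t : Trace) (n : Int32b)
  | diverges (T : InfTrace)
  | goeswrong (t : Trace)

/-- Membership in the set of "going wrong" behaviors. -/
def Behavior.Wrong (B : Behavior) : Prop := ∃ t, B = .goeswrong t

/-- The transition semantics of a program: states, labelled transitions (in the program's global
environment), initial states, final states with an exit code. -/
structure LTS where
  State : Type
  step : State → Trace → State → Prop
  initial : State → Prop
  final : State → Int32b → Prop

namespace LTS

inductive Star (L : LTS) : L.State → Trace → L.State → Prop
  | refl (S : L.State) : Star L S [] S
  | trans {S S' S'' : L.State} {t₁ t₂ : Trace} :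
      L.step S t₁ S' → Star L S' t₂ S'' → Star L S (t₁ ++ t₂) S''

inductive Plus (L : LTS) : L.State → Trace → L.State → Prop
  | intro {S S' S'' : L.State} {t₁ t₂ : Trace} :
      L.step S t₁ S' → L.Star S' t₂ S'' → Plus L S (t₁ ++ t₂) S''

/-- Infinite transition sequences, as a greatest fixpoint. -/
def Forever (L : LTS) (S : L.State) (T : InfTrace) : Prop :=
  ∃ X : L.State → InfTrace → Prop, X S T ∧
    ∀ S T, X S T → ∃ t S' T', L.step S t S' ∧ X S' T' ∧ T = (Stream'.Seq.ofList t).append T'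

/-- `P ⇓ B`. -/
inductive Behaves (L : LTS) : Behavior → Prop
  | converges {S S' : L.State} {t : Trace} {n : Int32b} :
      L.initial S → L.Star S t S' → L.final S' n → Behaves L (.converges t n)
  | diverges {S : L.State} {T : InfTrace} :
      L.initial S → L.Forever S T → Behaves L (.diverges T)
  | goeswrong {S S' : L.State} {t : Trace} :
      L.initial S → L.Star S t S' → (∀ t' S'', ¬ L.step S' t' S'') → (∀ n, ¬ L.final S' n) →
      Behaves L (.goeswrong t)

end LTS

/-- The conditions on initial and final states in a forward simulation. -/
structure SimulationEnds (L₁ L₂ : LTS) (R : L₁.State → L₂.State → Prop) : Prop where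
  initial_exists : ∀ S₁, L₁.initial S₁ → ∃ S₂, L₂.initial S₂
  initial : ∀ S₁ S₂, L₁.initial S₁ → L₂.initial S₂ → R S₁ S₂
  final : ∀ S₁ S₂ n, R S₁ S₂ → L₁.final S₁ n → L₂.final S₂ n

/-- `R` is a forward simulation of the "plus" kind. -/
structure PlusSimulation (L₁ L₂ : LTS) (R : L₁.State → L₂.State → Prop) : Prop
    extends SimulationEnds L₁ L₂ R where
  plus : ∀ S₁ S₂ t S₁', R S₁ S₂ → L₁.step S₁ t S₁' → ∃ S₂', L₂.Plus S₂ t S₂' ∧ R S₁' S₂'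

/-- `R` is a lock-step forward simulation for the source states that satisfy `I`. -/
structure LockStepSimulationOn (L₁ L₂ : LTS) (I : L₁.State → Prop)
    (R : L₁.State → L₂.State → Prop) : Prop extends SimulationEnds L₁ L₂ R where
  lockstep : ∀ S₁ S₂ t S₁', I S₁ → R S₁ S₂ → L₁.step S₁ t S₁' →
    ∃ S₂', L₂.step S₂ t S₂' ∧ R S₁' S₂'

/-! ## Machine registers and stack slots -/

/-- PowerPC registers available to Linear and Mach code (`R1`, `R2` and `F13` are reserved). -/
inductive MReg
  | R0 | R3 | R4 | R5 | R6 | R7 | R8 | R9 | R10 | R11 | R12 | R13 | R14 | R15 | R16 | R17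
  | R18 | R19 | R20 | R21 | R22 | R23 | R24 | R25 | R26 | R27 | R28 | R29 | R30 | R31
  | F0 | F1 | F2 | F3 | F4 | F5 | F6 | F7 | F8 | F9 | F10 | F11 | F12 | F14 | F15 | F16 | F17
  | F18 | F19 | F20 | F21 | F22 | F23 | F24 | F25 | F26 | F27 | F28 | F29 | F30 | F31
  deriving DecidableEq

def intCalleeSave : List MReg :=
  [.R13, .R14, .R15, .R16, .R17, .R18, .R19, .R20, .R21, .R22, .R23, .R24, .R25, .R26, .R27,
   .R28, .R29, .R30, .R31]

def floatCalleeSave : List MReg :=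
  [.F14, .F15, .F16, .F17, .F18, .F19, .F20, .F21, .F22, .F23, .F24, .F25, .F26, .F27, .F28,
   .F29, .F30, .F31]

def floatCallerSave : List MReg :=
  [.F0, .F1, .F2, .F3, .F4, .F5, .F6, .F7, .F8, .F9, .F10, .F11, .F12]

/-- The register class `τ(r)`. -/
def MReg.typ (r : MReg) : Typ :=
  if r ∈ floatCallerSave ∨ r ∈ floatCalleeSave then .float else .int

/-- All other registers are caller-save. -/
def MReg.CalleeSave (r : MReg) : Prop := r ∈ intCalleeSave ∨ r ∈ floatCalleeSave

instance (r : MReg) : Decidable r.CalleeSave := by unfold MReg.CalleeSave; infer_instance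

/-- Stack slots; `δ` is a word offset in the corresponding area. -/
inductive Slot
  | localSlot (τ : Typ) (δ : ℕ)
  | incoming (τ : Typ) (δ : ℕ)
  | outgoing (τ : Typ) (δ : ℕ)
  deriving DecidableEq

def Slot.typ : Slot → Typ
  | .localSlot τ _ | .incoming τ _ | .outgoing τ _ => τ

inductive Loc
  | reg (r : MReg)
  | slot (s : Slot)
  deriving DecidableEq

def wordsMeet (τ : Typ) (δ : ℕ) (τ' : Typ) (δ' : ℕ) : Prop :=
  δ < δ' + τ'.words ∧ δ' < δ + τ.words

/-- Overlap of stack slots. The integer and the float local slots lie in two separate areas. -/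
def Slot.Overlap : Slot → Slot → Prop
  | .localSlot τ δ, .localSlot τ' δ' => τ = τ' ∧ wordsMeet τ δ τ' δ'
  | .incoming τ δ, .incoming τ' δ' => wordsMeet τ δ τ' δ'
  | .outgoing τ δ, .outgoing τ' δ' => wordsMeet τ δ τ' δ'
  | _, _ => False

def Loc.Overlap : Loc → Loc → Prop
  | .reg r, .reg r' => r = r'
  | .slot s, .slot s' => s.Overlap s'
  | _, _ => False

instance (τ : Typ) (δ : ℕ) (τ' : Typ) (δ' : ℕ) : Decidable (wordsMeet τ δ τ' δ') := by
  unfold wordsMeet; infer_instance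

instance (s s' : Slot) : Decidable (s.Overlap s') := by
  cases s <;> cases s' <;> unfold Slot.Overlap <;> infer_instance

instance (l l' : Loc) : Decidable (l.Overlap l') := by
  cases l <;> cases l' <;> unfold Loc.Overlap <;> infer_instance

/-! ## Calling conventions -/

def intParamRegs : List MReg := [.R3, .R4, .R5, .R6, .R7, .R8, .R9, .R10]
def floatParamRegs : List MReg := [.F1, .F2, .F3, .F4, .F5, .F6, .F7, .F8]

/-- Locations of the arguments, given the remaining parameter registers and the next free word of
the outgoing area; also returns the final size of that area. -/
def locArgumentsFrom : List Typ → List MReg → List MReg → ℕ → List Loc × ℕ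
  | [], _, _, ofs => ([], ofs)
  | .int :: τs, r :: ir, fr, ofs =>
      let p := locArgumentsFrom τs ir fr ofs
      (.reg r :: p.1, p.2)
  | .int :: τs, [], fr, ofs =>
      let p := locArgumentsFrom τs [] fr (ofs + 1)
      (.slot (.outgoing .int ofs) :: p.1, p.2)
  | .float :: τs, ir, r :: fr, ofs =>
      let p := locArgumentsFrom τs ir fr ofs
      (.reg r :: p.1, p.2)
  | .float :: τs, ir, [], ofs =>
      let p := locArgumentsFrom τs ir [] (ofs + 2)
      (.slot (.outgoing .float ofs) :: p.1, p.2)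

def locArguments (s : Sig) : List Loc := (locArgumentsFrom s.args intParamRegs floatParamRegs 0).1

/-- Number of words of outgoing stack space used by the arguments. -/
def sizeArguments (s : Sig) : ℕ := (locArgumentsFrom s.args intParamRegs floatParamRegs 0).2

/-- Conventional locations of the parameters on the callee's side. -/
def locParameters (s : Sig) : List Loc :=
  (locArguments s).map fun
    | .slot (.outgoing τ δ) => .slot (.incoming τ δ)
    | ℓ => ℓ

def locResult (s : Sig) : MReg :=
  match s.resTyp with
  | .int => .R3
  | .float => .F1

/-! ## Operators, addressing modes, conditions -/

inductive Cond
  | comp (c : Comparison)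
  | compu (c : Comparison)
  | compimm (c : Comparison) (n : Int32b)
  | compuimm (c : Comparison) (n : Int32b)
  | compf (c : Comparison)

inductive Op
  | move
  | intconst (n : Int32b) | floatconst (f : Float64)
  | addrsymbol (id : Ident) (δ : Int32b) | addrstack (δ : Int32b)
  | negint | notbool | cast8s | cast8u | cast16s | cast16u
  | add | addi (n : Int32b) | sub | subi (n : Int32b) | mul | muli (n : Int32b) | div | divu
  | and | andi (n : Int32b) | or | ori (n : Int32b) | xor | xori (n : Int32b)
  | nand | nor | nxor
  | shl | shr | shri (n : Int32b) | shrxi (n : Int32b) | shru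
  | rolm (n m : Int32b)
  | negf | absf | addf | subf | mulf | divf | muladdf | mulsubf
  | singleoffloat | intoffloat | intuoffloat | floatofint | floatofintu
  | cmp (c : Cond)

inductive Mode
  | indexed (n : Int32b)
  | indexed2
  | global (id : Ident) (δ : Int32b)
  | based (id : Ident) (δ : Int32b)
  | stack (δ : Int32b)

/-- Comparison of pointers to different blocks, or of a pointer and the null pointer. -/
def evalMismatch : Comparison → Option Bool
  | .eq => some false
  | .ne => some true
  | _ => none

def evalComp (c : Comparison) : Val → Val → Option Bool
  | .int n₁, .int n₂ => some (cmpSigned c n₁ n₂)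
  | .ptr b₁ δ₁, .ptr b₂ δ₂ => if b₁ = b₂ then some (cmpSigned c δ₁ δ₂) else evalMismatch c
  | .ptr _ _, .int n => if n = 0 then evalMismatch c else none
  | .int n, .ptr _ _ => if n = 0 then evalMismatch c else none
  | _, _ => none

def evalCompu (c : Comparison) : Val → Val → Option Bool
  | .int n₁, .int n₂ => some (cmpUnsigned c n₁ n₂)
  | _, _ => none

def evalCond : Cond → List Val → Option Bool
  | .comp c, [v₁, v₂] => evalComp c v₁ v₂
  | .compu c, [v₁, v₂] => evalCompu c v₁ v₂
  | .compimm c n, [v] => evalComp c v (.int n)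
  | .compuimm c n, [v] => evalCompu c v (.int n)
  | .compf c, [.float f₁, .float f₂] => some (cmpFloat c f₁ f₂)
  | _, _ => none

def Val.ofBool (b : Bool) : Val := .int (if b then 1 else 0)

/-- Pointer arithmetic, modulo `2^32` on the offset. -/
def Val.addOfs : Val → Int32b → Option Val
  | .ptr b δ, n => some (.ptr b (δ + n))
  | _, _ => none

def symbolAddr {F : Type} (G : GEnv F) (id : Ident) (δ : Int32b) : Option Val :=
  (G.symbol id).map fun b => .ptr b δ

/-- `evalOp G sp op vs`; `sp` is the address of the base of the stack block. -/
def evalOp {F : Type} (G : GEnv F) (sp : Val) : Op → List Val → Option Val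
  | .move, [v] => some v
  | .intconst n, [] => some (.int n)
  | .floatconst f, [] => some (.float f)
  | .addrsymbol id δ, [] => symbolAddr G id δ
  | .addrstack δ, [] => sp.addOfs δ
  | .negint, [.int n] => some (.int (-n))
  | .notbool, [.int n] => some (Val.ofBool (n == 0))
  | .notbool, [.ptr _ _] => some (Val.ofBool false)
  | .cast8s, [.int n] => some (.int ((n.setWidth 8).signExtend 32))
  | .cast8u, [.int n] => some (.int ((n.setWidth 8).setWidth 32))
  | .cast16s, [.int n] => some (.int ((n.setWidth 16).signExtend 32))
  | .cast16u, [.int n] => some (.int ((n.setWidth 16).setWidth 32))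
  | .add, [.int n₁, .int n₂] => some (.int (n₁ + n₂))
  | .add, [.ptr b δ, .int n] => some (.ptr b (δ + n))
  | .add, [.int n, .ptr b δ] => some (.ptr b (δ + n))
  | .addi n, [.int n₁] => some (.int (n₁ + n))
  | .addi n, [.ptr b δ] => some (.ptr b (δ + n))
  | .sub, [.int n₁, .int n₂] => some (.int (n₁ - n₂))
  | .sub, [.ptr b δ, .int n] => some (.ptr b (δ - n))
  | .sub, [.ptr b₁ δ₁, .ptr b₂ δ₂] => if b₁ = b₂ then some (.int (δ₁ - δ₂)) else none
  | .subi n, [.int n₁] => some (.int (n - n₁))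
  | .mul, [.int n₁, .int n₂] => some (.int (n₁ * n₂))
  | .muli n, [.int n₁] => some (.int (n₁ * n))
  | .div, [.int n₁, .int n₂] => if n₂ = 0 then none else some (.int (n₁.sdiv n₂))
  | .divu, [.int n₁, .int n₂] => if n₂ = 0 then none else some (.int (n₁.udiv n₂))
  | .and, [.int n₁, .int n₂] => some (.int (n₁ &&& n₂))
  | .andi n, [.int n₁] => some (.int (n₁ &&& n))
  | .or, [.int n₁, .int n₂] => some (.int (n₁ ||| n₂))
  | .ori n, [.int n₁] => some (.int (n₁ ||| n))
  | .xor, [.int n₁, .int n₂] => some (.int (n₁ ^^^ n₂))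
  | .xori n, [.int n₁] => some (.int (n₁ ^^^ n))
  | .nand, [.int n₁, .int n₂] => some (.int (~~~(n₁ &&& n₂)))
  | .nor, [.int n₁, .int n₂] => some (.int (~~~(n₁ ||| n₂)))
  | .nxor, [.int n₁, .int n₂] => some (.int (~~~(n₁ ^^^ n₂)))
  | .shl, [.int n₁, .int n₂] => if n₂.toNat < 32 then some (.int (n₁ <<< n₂.toNat)) else none
  | .shr, [.int n₁, .int n₂] =>
      if n₂.toNat < 32 then some (.int (n₁.sshiftRight n₂.toNat)) else none
  | .shri n, [.int n₁] => if n.toNat < 32 then some (.int (n₁.sshiftRight n.toNat)) else none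
  | .shrxi n, [.int n₁] =>
      if n.toNat < 31 then some (.int (n₁.sdiv ((1 : Int32b) <<< n.toNat))) else none
  | .shru, [.int n₁, .int n₂] => if n₂.toNat < 32 then some (.int (n₁ >>> n₂.toNat)) else none
  | .rolm n m, [.int n₁] => some (.int (n₁.rotateLeft n.toNat &&& m))
  | .negf, [.float f] => some (.float (Float64.neg f))
  | .absf, [.float f] => some (.float (Float64.abs f))
  | .addf, [.float f₁, .float f₂] => some (.float (Float64.add f₁ f₂))
  | .subf, [.float f₁, .float f₂] => some (.float (Float64.sub f₁ f₂))
  | .mulf, [.float f₁, .float f₂] => some (.float (Float64.mul f₁ f₂))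
  | .divf, [.float f₁, .float f₂] => some (.float (Float64.div f₁ f₂))
  | .muladdf, [.float f₁, .float f₂, .float f₃] =>
      some (.float (Float64.add (Float64.mul f₁ f₂) f₃))
  | .mulsubf, [.float f₁, .float f₂, .float f₃] =>
      some (.float (Float64.sub (Float64.mul f₁ f₂) f₃))
  | .singleoffloat, [.float f] => some (.float (Float64.single f))
  | .intoffloat, [.float f] => (Float64.toInt f).map .int
  | .intuoffloat, [.float f] => (Float64.toUInt f).map .int
  | .floatofint, [.int n] => some (.float (Float64.ofInt n))
  | .floatofintu, [.int n] => some (.float (Float64.ofUInt n))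
  | .cmp c, vs => (evalCond c vs).map Val.ofBool
  | _, _ => none

def evalMode {F : Type} (G : GEnv F) (sp : Val) : Mode → List Val → Option Val
  | .indexed n, [v] => v.addOfs n
  | .indexed2, [.ptr b δ, .int n] => some (.ptr b (δ + n))
  | .indexed2, [.int n, .ptr b δ] => some (.ptr b (δ + n))
  | .global id δ, [] => symbolAddr G id δ
  | .based id δ, [.int n] => symbolAddr G id (δ + n)
  | .stack δ, [] => sp.addOfs δ
  | _, _ => none

/-- Argument types of a condition. -/
def Cond.typ : Cond → List Typ
  | .comp _ | .compu _ => [.int, .int]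
  | .compimm _ _ | .compuimm _ _ => [.int]
  | .compf _ => [.float, .float]

/-- Argument types and result type of an operator other than the polymorphic `move`. -/
def Op.typ : Op → List Typ × Typ
  | .move => ([.int], .int)
  | .intconst _ | .addrsymbol _ _ | .addrstack _ => ([], .int)
  | .floatconst _ => ([], .float)
  | .negint | .notbool | .cast8s | .cast8u | .cast16s | .cast16u
  | .addi _ | .subi _ | .muli _ | .andi _ | .ori _ | .xori _ | .shri _ | .shrxi _ | .rolm _ _ =>
      ([.int], .int)
  | .add | .sub | .mul | .div | .divu | .and | .or | .xor | .nand | .nor | .nxor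
  | .shl | .shr | .shru => ([.int, .int], .int)
  | .negf | .absf | .singleoffloat => ([.float], .float)
  | .addf | .subf | .mulf | .divf => ([.float, .float], .float)
  | .muladdf | .mulsubf => ([.float, .float, .float], .float)
  | .intoffloat | .intuoffloat => ([.float], .int)
  | .floatofint | .floatofintu => ([.int], .float)
  | .cmp c => (c.typ, .int)

/-- Argument types of an addressing mode. -/
def Mode.typ : Mode → List Typ
  | .indexed _ | .based _ _ => [.int]
  | .indexed2 => [.int, .int]
  | .global _ _ | .stack _ => []

/-- The typing rule for `op(op, args, res)`. -/
def WTOp (op : Op) (args : List MReg) (res : MReg) : Prop :=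
  (op = .move ∧ ∃ r, args = [r] ∧ r.typ = res.typ) ∨
  (op ≠ .move ∧ (args.map MReg.typ, res.typ) = op.typ)

/-- The function called by a `call` or `tailcall`: in a register, or a global name. -/
inductive FunRef
  | reg (r : MReg)
  | sym (id : Ident)

def findFunction {F : Type} (G : GEnv F) (rs : MReg → Val) : FunRef → Option (FunDef F)
  | .reg r =>
      match rs r with
      | .ptr b δ => if δ = 0 then G.funct b else none
      | _ => none
  | .sym id => (G.symbol id).bind G.funct

/-- A function in a register is designated by an integer register. -/
def FunRef.WT : FunRef → Prop
  | .reg r => r.typ = .int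
  | .sym _ => True

/-- The register, if any, is not callee-save. -/
def FunRef.NotCalleeSave : FunRef → Prop
  | .reg r => ¬ r.CalleeSave
  | .sym _ => True

/-! ## Linear -/

namespace Linear

inductive Instr
  | getstack (s : Slot) (r : MReg)
  | setstack (r : MReg) (s : Slot)
  | op (o : Op) (args : List MReg) (res : MReg)
  | load (κ : Chunk) (m : Mode) (args : List MReg) (dst : MReg)
  | store (κ : Chunk) (m : Mode) (args : List MReg) (src : MReg)
  | call (sig : Sig) (f : FunRef)
  | tailcall (sig : Sig) (f : FunRef)
  | cond (c : Cond) (args : List MReg) (l : Label)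
  | goto (l : Label)
  | label (l : Label)
  | ret

abbrev Code := List Instr

structure Fn where
  sig : Sig
  stacksize : ℕ
  code : Code

abbrev LocMap := Loc → Val

def LocMap.regs (L : LocMap) (r : MReg) : Val := L (.reg r)

/-- Overlap-aware update `L{ℓ ← v}`. -/
def LocMap.set (L : LocMap) (ℓ : Loc) (v : Val) : LocMap := fun ℓ' =>
  if ℓ = ℓ' then v else if ℓ.Overlap ℓ' then .undef else L ℓ'

def undefMap : LocMap := fun _ => .undef

def entryfun (L : LocMap) : LocMap
  | .reg r => L (.reg r)
  | .slot (.localSlot _ _) => .undef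
  | .slot (.incoming τ δ) => L (.slot (.outgoing τ δ))
  | .slot (.outgoing _ _) => .undef

/-- `L`: the caller's locations before the call; `L'`: the callee's locations before it returns. -/
def exitfun (L L' : LocMap) : LocMap
  | .reg r => if r.CalleeSave then L (.reg r) else L' (.reg r)
  | .slot (.localSlot τ δ) => L (.slot (.localSlot τ δ))
  | .slot (.incoming τ δ) => L (.slot (.incoming τ δ))
  | .slot (.outgoing τ δ) => L' (.slot (.incoming τ δ))

structure Frame where
  fn : Fn
  σ : Block
  c : Code
  locs : LocMap

inductive State
  | regular (stk : List Frame) (F : Fn) (σ : Block) (c : Code) (L : LocMap) (M : Mem)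
  | call (stk : List Frame) (fd : FunDef Fn) (L : LocMap) (M : Mem)
  | ret (stk : List Frame) (L : LocMap) (M : Mem)

def State.locs : State → LocMap
  | .regular _ _ _ _ L _ | .call _ _ L _ | .ret _ L _ => L

def State.mem : State → Mem
  | .regular _ _ _ _ _ M | .call _ _ _ M | .ret _ _ M => M

def parentLocs : List Frame → LocMap
  | [] => undefMap
  | fr :: _ => fr.locs

def funSig : FunDef Fn → Sig
  | .internal F => F.sig
  | .external fe => fe.sig

/-- The maximal suffix that starts with `label(l)`. -/
def findLabel (l : Label) : Code → Option Code
  | [] => none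
  | .label l' :: c => if l' = l then some (.label l' :: c) else findLabel l c
  | _ :: c => findLabel l c

inductive Step (G : GEnv Fn) : State → Trace → State → Prop
  | getstack {stk F σ s r c L M} :
      Step G (.regular stk F σ (.getstack s r :: c) L M) []
        (.regular stk F σ c (L.set (.reg r) (L (.slot s))) M)
  | setstack {stk F σ r s c L M} :
      Step G (.regular stk F σ (.setstack r s :: c) L M) []
        (.regular stk F σ c (L.set (.slot s) (L (.reg r))) M)
  | op {stk F σ o args res c L M v} :
      evalOp G (.ptr σ 0) o (args.map L.regs) = some v →
      Step G (.regular stk F σ (.op o args res :: c) L M) []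
        (.regular stk F σ c (L.set (.reg res) v) M)
  | load {stk F σ κ m args dst c L M b δ v} :
      evalMode G (.ptr σ 0) m (args.map L.regs) = some (.ptr b δ) →
      M.load κ b δ.toInt = some v →
      Step G (.regular stk F σ (.load κ m args dst :: c) L M) []
        (.regular stk F σ c (L.set (.reg dst) v) M)
  | store {stk F σ κ m args src c L M b δ M'} :
      evalMode G (.ptr σ 0) m (args.map L.regs) = some (.ptr b δ) →
      M.store κ b δ.toInt (L (.reg src)) = some M' →
      Step G (.regular stk F σ (.store κ m args src :: c) L M) []
        (.regular stk F σ c L M')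
  | call {stk F σ sig f c L M fd} :
      findFunction G L.regs f = some fd → funSig fd = sig →
      Step G (.regular stk F σ (.call sig f :: c) L M) []
        (.call (⟨F, σ, c, L⟩ :: stk) fd L M)
  | tailcall {stk F σ sig f c L M fd} :
      findFunction G L.regs f = some fd → funSig fd = sig →
      Step G (.regular stk F σ (.tailcall sig f :: c) L M) []
        (.call stk fd (exitfun (parentLocs stk) L) (M.free σ))
  | cond_true {stk F σ cnd args l c L M c'} :
      evalCond cnd (args.map L.regs) = some true → findLabel l F.code = some c' →
      Step G (.regular stk F σ (.cond cnd args l :: c) L M) []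
        (.regular stk F σ c' L M)
  | cond_false {stk F σ cnd args l c L M} :
      evalCond cnd (args.map L.regs) = some false →
      Step G (.regular stk F σ (.cond cnd args l :: c) L M) []
        (.regular stk F σ c L M)
  | goto {stk F σ l c L M c'} :
      findLabel l F.code = some c' →
      Step G (.regular stk F σ (.goto l :: c) L M) [] (.regular stk F σ c' L M)
  | label {stk F σ l c L M} :
      Step G (.regular stk F σ (.label l :: c) L M) [] (.regular stk F σ c L M)
  | ret {stk F σ c L M} :
      Step G (.regular stk F σ (.ret :: c) L M) []
        (.ret stk (exitfun (parentLocs stk) L) (M.free σ))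
  | internal {stk F L M σ M'} :
      M.alloc 0 F.stacksize = (σ, M') →
      Step G (.call stk (.internal F) L M) []
        (.regular stk F σ F.code (entryfun L) M')
  | external {stk fe} {L : LocMap} {M t v} :
      ExtCall fe ((locArguments fe.sig).map L) t v →
      Step G (.call stk (.external fe) L M) t
        (.ret stk (L.set (.reg (locResult fe.sig)) v) M)
  | resume {stk F σ c L₀ L M} :
      Step G (.ret (⟨F, σ, c, L₀⟩ :: stk) L M) [] (.regular stk F σ c L M)

inductive Initial (P : Program Fn) : State → Prop
  | intro {b fd} :
      (globalenv P).symbol P.main = some b → (globalenv P).funct b = some fd →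
      funSig fd = mainSig → Initial P (.call [] fd undefMap (initmem P))

inductive Final : State → Int32b → Prop
  | intro {L M n} : L (.reg (locResult mainSig)) = .int n → Final (.ret [] L M) n

def sem (P : Program Fn) : LTS where
  State := State
  step := Step (globalenv P)
  initial := Initial P
  final := Final

/-- Typing of instructions in the `int`-or-`float` type system. The rules also carry the syntactic
restrictions on slots and tail calls: `incoming` slots are parameters of the function and are
read-only; a tail call leaves no function pointer in a callee-save register and takes no stack
argument that is not already a stack parameter of the calling function. -/
def WTInstr (F : Fn) : Instr → Prop
  | .getstack s r =>
      s.typ = r.typ ∧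
      match s with
      | .incoming τ δ => Loc.slot (.incoming τ δ) ∈ locParameters F.sig
      | _ => True
  | .setstack r s =>
      s.typ = r.typ ∧
      match s with
      | .incoming _ _ => False
      | _ => True
  | .op o args res => WTOp o args res
  | .load κ m args dst => args.map MReg.typ = m.typ ∧ dst.typ = κ.typ
  | .store κ m args src => args.map MReg.typ = m.typ ∧ src.typ = κ.typ
  | .call _ f => f.WT
  | .tailcall sig f =>
      f.WT ∧ f.NotCalleeSave ∧
      ∀ s, Loc.slot s ∈ locArguments sig → Loc.slot s ∈ locArguments F.sig
  | .cond c args _ => args.map MReg.typ = c.typ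
  | .goto _ | .label _ | .ret => True

def WTFn (F : Fn) : Prop := ∀ i ∈ F.code, WTInstr F i

def WTProgram (P : Program Fn) : Prop := ∀ id F, (id, FunDef.internal F) ∈ P.functs → WTFn F

end Linear

/-! ## Mach -/

namespace Mach

/-- In the three stack instructions `δ` is a byte offset from the stack pointer, i.e. from the
low end of the activation record (of the caller, for `getparent`). -/
inductive Instr
  | setstack (r : MReg) (τ : Typ) (δ : ℤ)
  | getstack (τ : Typ) (δ : ℤ) (r : MReg)
  | getparent (τ : Typ) (δ : ℤ) (r : MReg)
  | op (o : Op) (args : List MReg) (res : MReg)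
  | load (κ : Chunk) (m : Mode) (args : List MReg) (dst : MReg)
  | store (κ : Chunk) (m : Mode) (args : List MReg) (src : MReg)
  | call (sig : Sig) (f : FunRef)
  | tailcall (sig : Sig) (f : FunRef)
  | cond (c : Cond) (args : List MReg) (l : Label)
  | goto (l : Label)
  | label (l : Label)
  | ret

abbrev Code := List Instr

structure Fn where
  sig : Sig
  stackHigh : ℤ
  stackLow : ℤ
  retaddr : ℤ
  link : ℤ
  code : Code

abbrev RegMap := MReg → Val

def undefRegs : RegMap := fun _ => .undef

def RegMap.set (R : RegMap) (r : MReg) (v : Val) : RegMap := Function.update R r v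

def funSig : FunDef Fn → Sig
  | .internal F => F.sig
  | .external fe => fe.sig

/-- The maximal suffix that starts with `label(l)`. -/
def findLabel (l : Label) : Code → Option Code
  | [] => none
  | .label l' :: c => if l' = l then some (.label l' :: c) else findLabel l c
  | _ :: c => findLabel l c

/-- Byte offset from the stack pointer of the outgoing argument area, in every frame. -/
def outgoingBase : ℤ := 8

/-- The stack pointer in the activation record with block `b` of function `F`. -/
def stackPtr (F : Fn) (b : Block) : Val := .ptr b (BitVec.ofInt 32 F.stackLow)

/-! ### Standard semantics -/

def loadstack (τ : Typ) (M : Mem) (σ : Val) (δ : ℤ) : Option Val :=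
  match σ with
  | .ptr b δ' => M.load τ.chunk b (δ' + BitVec.ofInt 32 δ).toInt
  | _ => none

def storestack (τ : Typ) (M : Mem) (σ : Val) (δ : ℤ) (v : Val) : Option Mem :=
  match σ with
  | .ptr b δ' => M.store τ.chunk b (δ' + BitVec.ofInt 32 δ).toInt v
  | _ => none

structure Frame where
  fn : Fn
  σ : Val
  ra : Val
  c : Code

inductive State
  | regular (stk : List Frame) (F : Fn) (σ : Val) (c : Code) (R : RegMap) (M : Mem)
  | call (stk : List Frame) (fd : FunDef Fn) (R : RegMap) (M : Mem)
  | ret (stk : List Frame) (R : RegMap) (M : Mem)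

def State.regs : State → RegMap
  | .regular _ _ _ _ R _ | .call _ _ R _ | .ret _ R _ => R

def State.mem : State → Mem
  | .regular _ _ _ _ _ M | .call _ _ _ M | .ret _ _ M => M

/-- Stack pointer of the caller; null if there is no caller. -/
def parentSp : List Frame → Val
  | [] => .int 0
  | fr :: _ => fr.σ

/-- Return address into the caller; null if there is no caller. -/
def parentRa : List Frame → Val
  | [] => .int 0
  | fr :: _ => fr.ra

/-- Value of an external call argument, found in a register or in the caller's frame. -/
def extArg (R : RegMap) (M : Mem) (sp : Val) : Loc → Option Val
  | .reg r => some (R r)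
  | .slot (.outgoing τ δ) => loadstack τ M sp (outgoingBase + 4 * δ)
  | _ => none

/-- The oracle `retaddr F c b δ`: `ptr(b, δ)` is the return address into the code of `F` for a call
that is immediately followed by `c`. -/
abbrev RetAddr := Fn → Code → Block → Int32b → Prop

inductive Step (retaddr : RetAddr) (G : GEnv Fn) : State → Trace → State → Prop
  | setstack {stk F σ r τ δ c R M M'} :
      storestack τ M σ δ (R r) = some M' →
      Step retaddr G (.regular stk F σ (.setstack r τ δ :: c) R M) []
        (.regular stk F σ c R M')
  | getstack {stk F σ τ δ r c R M v} :
      loadstack τ M σ δ = some v →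
      Step retaddr G (.regular stk F σ (.getstack τ δ r :: c) R M) []
        (.regular stk F σ c (R.set r v) M)
  | getparent {stk F σ τ δ r c R M σ' v} :
      loadstack .int M σ F.link = some σ' → loadstack τ M σ' δ = some v →
      Step retaddr G (.regular stk F σ (.getparent τ δ r :: c) R M) []
        (.regular stk F σ c (R.set r v) M)
  | op {stk F σ o args res c R M v} :
      evalOp G σ o (args.map R) = some v →
      Step retaddr G (.regular stk F σ (.op o args res :: c) R M) []
        (.regular stk F σ c (R.set res v) M)
  | load {stk F σ κ m args dst c R M b δ v} :
      evalMode G σ m (args.map R) = some (.ptr b δ) →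
      M.load κ b δ.toInt = some v →
      Step retaddr G (.regular stk F σ (.load κ m args dst :: c) R M) []
        (.regular stk F σ c (R.set dst v) M)
  | store {stk F σ κ m args src c R M b δ M'} :
      evalMode G σ m (args.map R) = some (.ptr b δ) →
      M.store κ b δ.toInt (R src) = some M' →
      Step retaddr G (.regular stk F σ (.store κ m args src :: c) R M) []
        (.regular stk F σ c R M')
  | call {stk F σ sig f c R M fd b δ} :
      findFunction G R f = some fd → funSig fd = sig → retaddr F c b δ →
      Step retaddr G (.regular stk F σ (.call sig f :: c) R M) []
        (.call (⟨F, σ, .ptr b δ, c⟩ :: stk) fd R M)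
  | tailcall {stk F b δ sig f c R M fd} :
      findFunction G R f = some fd → funSig fd = sig →
      loadstack .int M (.ptr b δ) F.link = some (parentSp stk) →
      loadstack .int M (.ptr b δ) F.retaddr = some (parentRa stk) →
      Step retaddr G (.regular stk F (.ptr b δ) (.tailcall sig f :: c) R M) []
        (.call stk fd R (M.free b))
  | cond_true {stk F σ cnd args l c R M c'} :
      evalCond cnd (args.map R) = some true → findLabel l F.code = some c' →
      Step retaddr G (.regular stk F σ (.cond cnd args l :: c) R M) []
        (.regular stk F σ c' R M)
  | cond_false {stk F σ cnd args l c R M} :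
      evalCond cnd (args.map R) = some false →
      Step retaddr G (.regular stk F σ (.cond cnd args l :: c) R M) []
        (.regular stk F σ c R M)
  | goto {stk F σ l c R M c'} :
      findLabel l F.code = some c' →
      Step retaddr G (.regular stk F σ (.goto l :: c) R M) [] (.regular stk F σ c' R M)
  | label {stk F σ l c R M} :
      Step retaddr G (.regular stk F σ (.label l :: c) R M) [] (.regular stk F σ c R M)
  | ret {stk F b δ c R M} :
      loadstack .int M (.ptr b δ) F.link = some (parentSp stk) →
      loadstack .int M (.ptr b δ) F.retaddr = some (parentRa stk) →
      Step retaddr G (.regular stk F (.ptr b δ) (.ret :: c) R M) []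
        (.ret stk R (M.free b))
  | internal {stk F R M b M₁ M₂ M₃} :
      M.alloc F.stackLow F.stackHigh = (b, M₁) →
      storestack .int M₁ (stackPtr F b) F.link (parentSp stk) = some M₂ →
      storestack .int M₂ (stackPtr F b) F.retaddr (parentRa stk) = some M₃ →
      Step retaddr G (.call stk (.internal F) R M) []
        (.regular stk F (stackPtr F b) F.code R M₃)
  | external {stk fe R M vs t v} :
      (locArguments fe.sig).mapM (extArg R M (parentSp stk)) = some vs → ExtCall fe vs t v →
      Step retaddr G (.call stk (.external fe) R M) t
        (.ret stk (R.set (locResult fe.sig) v) M)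
  | resume {stk F σ ra c R M} :
      Step retaddr G (.ret (⟨F, σ, ra, c⟩ :: stk) R M) [] (.regular stk F σ c R M)

inductive Initial (P : Program Fn) : State → Prop
  | intro {b fd} :
      (globalenv P).symbol P.main = some b → (globalenv P).funct b = some fd →
      funSig fd = mainSig → Initial P (.call [] fd undefRegs (initmem P))

inductive Final : State → Int32b → Prop
  | intro {R M n} : R (locResult mainSig) = .int n → Final (.ret [] R M) n

def sem (retaddr : RetAddr) (P : Program Fn) : LTS where
  State := State
  step := Step retaddr (globalenv P)
  initial := Initial P
  final := Final

/-- The oracle provides a return address for every `call` occurring in the program. -/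
def HasReturnAddresses (retaddr : RetAddr) (P : Program Fn) : Prop :=
  ∀ id F, (id, FunDef.internal F) ∈ P.functs →
    ∀ sig f c, (Instr.call sig f :: c) <:+ F.code → ∃ b δ, retaddr F c b δ

/-! ### Alternate semantics, with abstract frames -/

/-- Abstract frames, indexed by types and byte offsets from the stack pointer. -/
abbrev FrameEnv := Typ → ℤ → Val

def undefFrame : FrameEnv := fun _ _ => .undef

/-- Overlap-aware update `Φ{(τ,δ) ← v}`. -/
def FrameEnv.set (Φ : FrameEnv) (τ : Typ) (δ : ℤ) (v : Val) : FrameEnv := fun τ' δ' =>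
  if τ = τ' ∧ δ = δ' then v
  else if δ < δ' + τ'.size ∧ δ' < δ + τ.size then .undef
  else Φ τ' δ'

/-- The bytes `[δ, δ + |τ|)` lie in the frame part of the activation record, outside the places
reserved for the back link and the return address. -/
def SlotValid (F : Fn) (τ : Typ) (δ : ℤ) : Prop :=
  0 ≤ δ ∧ δ + τ.size ≤ -F.stackLow ∧
  (δ + τ.size ≤ F.link ∨ F.link + 4 ≤ δ) ∧ (δ + τ.size ≤ F.retaddr ∨ F.retaddr + 4 ≤ δ)

instance (F : Fn) (τ : Typ) (δ : ℤ) : Decidable (SlotValid F τ δ) := by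
  unfold SlotValid; infer_instance

def getFrame (F : Fn) (Φ : FrameEnv) (τ : Typ) (δ : ℤ) : Option Val :=
  if SlotValid F τ δ then some (Φ τ δ) else none

def setFrame (F : Fn) (Φ : FrameEnv) (τ : Typ) (δ : ℤ) (v : Val) : Option FrameEnv :=
  if SlotValid F τ δ then some (Φ.set τ δ v) else none

structure AltFrame where
  fn : Fn
  σ : Val
  c : Code
  Φ : FrameEnv

inductive AltState
  | regular (stk : List AltFrame) (F : Fn) (σ : Val) (c : Code) (R : RegMap) (Φ : FrameEnv)
      (M : Mem)
  | call (stk : List AltFrame) (fd : FunDef Fn) (R : RegMap) (M : Mem)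
  | ret (stk : List AltFrame) (R : RegMap) (M : Mem)

def AltState.regs : AltState → RegMap
  | .regular _ _ _ _ R _ _ | .call _ _ R _ | .ret _ R _ => R

def AltState.mem : AltState → Mem
  | .regular _ _ _ _ _ _ M | .call _ _ _ M | .ret _ _ M => M

/-- Access to the caller's abstract frame. -/
def getParentFrame (stk : List AltFrame) (τ : Typ) (δ : ℤ) : Option Val :=
  match stk with
  | [] => none
  | fr :: _ => getFrame fr.fn fr.Φ τ δ

def altExtArg (R : RegMap) (stk : List AltFrame) : Loc → Option Val
  | .reg r => some (R r)
  | .slot (.outgoing τ δ) => getParentFrame stk τ (outgoingBase + 4 * δ)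
  | _ => none

inductive AltStep (G : GEnv Fn) : AltState → Trace → AltState → Prop
  | setstack {stk F σ r τ δ c R Φ M Φ'} :
      setFrame F Φ τ δ (R r) = some Φ' →
      AltStep G (.regular stk F σ (.setstack r τ δ :: c) R Φ M) []
        (.regular stk F σ c R Φ' M)
  | getstack {stk F σ τ δ r c R Φ M v} :
      getFrame F Φ τ δ = some v →
      AltStep G (.regular stk F σ (.getstack τ δ r :: c) R Φ M) []
        (.regular stk F σ c (R.set r v) Φ M)
  | getparent {stk F σ τ δ r c R Φ M v} :
      getParentFrame stk τ δ = some v →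
      AltStep G (.regular stk F σ (.getparent τ δ r :: c) R Φ M) []
        (.regular stk F σ c (R.set r v) Φ M)
  | op {stk F σ o args res c R Φ M v} :
      evalOp G σ o (args.map R) = some v →
      AltStep G (.regular stk F σ (.op o args res :: c) R Φ M) []
        (.regular stk F σ c (R.set res v) Φ M)
  | load {stk F σ κ m args dst c R Φ M b δ v} :
      evalMode G σ m (args.map R) = some (.ptr b δ) →
      M.load κ b δ.toInt = some v →
      AltStep G (.regular stk F σ (.load κ m args dst :: c) R Φ M) []
        (.regular stk F σ c (R.set dst v) Φ M)
  | store {stk F σ κ m args src c R Φ M b δ M'} :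
      evalMode G σ m (args.map R) = some (.ptr b δ) →
      M.store κ b δ.toInt (R src) = some M' →
      AltStep G (.regular stk F σ (.store κ m args src :: c) R Φ M) []
        (.regular stk F σ c R Φ M')
  | call {stk F σ sig f c R Φ M fd} :
      findFunction G R f = some fd → funSig fd = sig →
      AltStep G (.regular stk F σ (.call sig f :: c) R Φ M) []
        (.call (⟨F, σ, c, Φ⟩ :: stk) fd R M)
  | tailcall {stk F b δ sig f c R Φ M fd} :
      findFunction G R f = some fd → funSig fd = sig →
      AltStep G (.regular stk F (.ptr b δ) (.tailcall sig f :: c) R Φ M) []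
        (.call stk fd R (M.free b))
  | cond_true {stk F σ cnd args l c R Φ M c'} :
      evalCond cnd (args.map R) = some true → findLabel l F.code = some c' →
      AltStep G (.regular stk F σ (.cond cnd args l :: c) R Φ M) []
        (.regular stk F σ c' R Φ M)
  | cond_false {stk F σ cnd args l c R Φ M} :
      evalCond cnd (args.map R) = some false →
      AltStep G (.regular stk F σ (.cond cnd args l :: c) R Φ M) []
        (.regular stk F σ c R Φ M)
  | goto {stk F σ l c R Φ M c'} :
      findLabel l F.code = some c' →
      AltStep G (.regular stk F σ (.goto l :: c) R Φ M) [] (.regular stk F σ c' R Φ M)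
  | label {stk F σ l c R Φ M} :
      AltStep G (.regular stk F σ (.label l :: c) R Φ M) [] (.regular stk F σ c R Φ M)
  | ret {stk F b δ c R Φ M} :
      AltStep G (.regular stk F (.ptr b δ) (.ret :: c) R Φ M) []
        (.ret stk R (M.free b))
  | internal {stk F R M b M'} :
      M.alloc 0 F.stackHigh = (b, M') →
      AltStep G (.call stk (.internal F) R M) []
        (.regular stk F (stackPtr F b) F.code R undefFrame M')
  | external {stk fe R M vs t v} :
      (locArguments fe.sig).mapM (altExtArg R stk) = some vs → ExtCall fe vs t v →
      AltStep G (.call stk (.external fe) R M) t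
        (.ret stk (R.set (locResult fe.sig) v) M)
  | resume {stk F σ c Φ R M} :
      AltStep G (.ret (⟨F, σ, c, Φ⟩ :: stk) R M) [] (.regular stk F σ c R Φ M)

inductive AltInitial (P : Program Fn) : AltState → Prop
  | intro {b fd} :
      (globalenv P).symbol P.main = some b → (globalenv P).funct b = some fd →
      funSig fd = mainSig → AltInitial P (.call [] fd undefRegs (initmem P))

inductive AltFinal : AltState → Int32b → Prop
  | intro {R M n} : R (locResult mainSig) = .int n → AltFinal (.ret [] R M) n

def altSem (P : Program Fn) : LTS where
  State := AltState
  step := AltStep (globalenv P)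
  initial := AltInitial P
  final := AltFinal

/-! ### The `int`-or-`float` type system -/

def WTInstr : Instr → Prop
  | .setstack r τ _ | .getstack τ _ r | .getparent τ _ r => r.typ = τ
  | .op o args res => WTOp o args res
  | .load κ m args dst => args.map MReg.typ = m.typ ∧ dst.typ = κ.typ
  | .store κ m args src => args.map MReg.typ = m.typ ∧ src.typ = κ.typ
  | .call _ f | .tailcall _ f => f.WT
  | .cond c args _ => args.map MReg.typ = c.typ
  | .goto _ | .label _ | .ret => True

def WTCode (c : Code) : Prop := ∀ i ∈ c, WTInstr i

/-- Well-typed functions. The frame part occupies `[stackLow, 0)`, is addressable by signed 32-bit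
offsets, and contains disjoint places for the back link and the return address. -/
structure WTFn (F : Fn) : Prop where
  code : WTCode F.code
  high : 0 ≤ F.stackHigh
  low : -(2 ^ 31) ≤ F.stackLow ∧ F.stackLow ≤ 0
  link : 0 ≤ F.link ∧ F.link + 4 ≤ -F.stackLow
  retaddr : 0 ≤ F.retaddr ∧ F.retaddr + 4 ≤ -F.stackLow
  disjoint : F.link + 4 ≤ F.retaddr ∨ F.retaddr + 4 ≤ F.link

def WTFunDef : FunDef Fn → Prop
  | .internal F => WTFn F
  | .external _ => True

def WTProgram (P : Program Fn) : Prop := ∀ id fd, (id, fd) ∈ P.functs → WTFunDef fd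

def WTRegs (R : RegMap) : Prop := ∀ r, (R r).HasType r.typ

def WTFrameEnv (Φ : FrameEnv) : Prop := ∀ τ δ, (Φ τ δ).HasType τ

def WTStack (stk : List AltFrame) : Prop :=
  ∀ fr ∈ stk, WTFn fr.fn ∧ WTCode fr.c ∧ WTFrameEnv fr.Φ

/-- Well-typed states of the alternate semantics. -/
def WTState : AltState → Prop
  | .regular stk F _ c R Φ _ => WTStack stk ∧ WTFn F ∧ WTCode c ∧ WTRegs R ∧ WTFrameEnv Φ
  | .call stk fd R _ => WTStack stk ∧ WTFunDef fd ∧ WTRegs R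
  | .ret stk R _ => WTStack stk ∧ WTRegs R

end Mach

/-! ## The translation from Linear to Mach -/

namespace Stacking

/-- Registers mentioned by an instruction. -/
def regsOf : Linear.Instr → List MReg
  | .getstack _ r | .setstack r _ => [r]
  | .op _ args res => res :: args
  | .load _ _ args dst => dst :: args
  | .store _ _ args src => src :: args
  | .call _ (.reg r) | .tailcall _ (.reg r) => [r]
  | .cond _ args _ => args
  | _ => []

def usedRegs (F : Linear.Fn) : List MReg := F.code.flatMap regsOf

/-- The callee-save registers used by the function. -/
def savedInt (F : Linear.Fn) : List MReg := intCalleeSave.filter (· ∈ usedRegs F)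
def savedFloat (F : Linear.Fn) : List MReg := floatCalleeSave.filter (· ∈ usedRegs F)

def maxOver (F : Linear.Fn) (f : Linear.Instr → ℕ) : ℕ := (F.code.map f).foldr max 0

/-- Number of words of the local area of type `τ` that a slot needs. -/
def localNeed (τ : Typ) : Slot → ℕ
  | .localSlot τ' δ => if τ' = τ then δ + τ.words else 0
  | _ => 0

def outgoingNeed : Slot → ℕ
  | .outgoing τ δ => δ + τ.words
  | _ => 0

def localWords (F : Linear.Fn) (τ : Typ) : ℕ :=
  maxOver F fun
    | .getstack s _ | .setstack _ s => localNeed τ s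
    | _ => 0

/-- Words needed for the outgoing slots that are used, and for the arguments of all calls. -/
def outgoingWords (F : Linear.Fn) : ℕ :=
  maxOver F fun
    | .getstack s _ | .setstack _ s => outgoingNeed s
    | .call sig _ => sizeArguments sig
    | _ => 0

def align8 (n : ℕ) : ℕ := (n + 7) / 8 * 8

/-! Byte offsets, from the low end of the activation record, of its successive areas: back link and
return address, outgoing arguments, integer locals, saved integer registers, padding, float locals,
saved float registers; the Cminor stack data comes next, at offset `frameSize`. -/

def ofsLink : ℕ := 0
def ofsRetaddr : ℕ := 4
def ofsOutgoing : ℕ := 8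
def ofsIntLocal (F : Linear.Fn) : ℕ := ofsOutgoing + 4 * outgoingWords F
def ofsIntSaved (F : Linear.Fn) : ℕ := ofsIntLocal F + 4 * localWords F .int
def ofsFloatLocal (F : Linear.Fn) : ℕ := align8 (ofsIntSaved F + 4 * (savedInt F).length)
def ofsFloatSaved (F : Linear.Fn) : ℕ := align8 (ofsFloatLocal F + 4 * localWords F .float)
def frameSize (F : Linear.Fn) : ℕ := ofsFloatSaved F + 8 * (savedFloat F).length

/-- The map `Δ` on stack slots. Offsets are relative to the stack pointer; relative to the origin
of the block, which is the start of the Cminor stack data, they are `slotOfs F s - frameSize F`,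
hence negative. An incoming slot is mapped to the corresponding outgoing slot of the caller. -/
def slotOfs (F : Linear.Fn) : Slot → ℤ
  | .localSlot .int δ => ofsIntLocal F + 4 * δ
  | .localSlot .float δ => ofsFloatLocal F + 4 * δ
  | .incoming _ δ | .outgoing _ δ => ofsOutgoing + 4 * δ

/-- The map `Δ` on the used callee-save registers. -/
def regOfs (F : Linear.Fn) (r : MReg) : ℤ :=
  if r ∈ savedInt F then ofsIntSaved F + 4 * ((savedInt F).idxOf r : ℤ)
  else ofsFloatSaved F + 8 * ((savedFloat F).idxOf r : ℤ)

def saved (F : Linear.Fn) : List MReg := savedInt F ++ savedFloat F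

def saveCode (F : Linear.Fn) : Mach.Code :=
  (saved F).map fun r => .setstack r r.typ (regOfs F r)

def restoreCode (F : Linear.Fn) : Mach.Code :=
  (saved F).map fun r => .getstack r.typ (regOfs F r) r

/-- Stack-relative operands are shifted, since the stack pointer now denotes the low end of the
activation record and no longer the start of the Cminor stack data. -/
def transfOp (F : Linear.Fn) : Op → Op
  | .addrstack δ => .addrstack (BitVec.ofNat 32 (frameSize F) + δ)
  | o => o

def transfMode (F : Linear.Fn) : Mode → Mode
  | .stack δ => .stack (BitVec.ofNat 32 (frameSize F) + δ)
  | m => m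

/-- Assignments to incoming slots do not occur in well-typed code. -/
def transfInstr (F : Linear.Fn) : Linear.Instr → Mach.Code
  | .getstack (.incoming τ δ) r => [.getparent τ (slotOfs F (.outgoing τ δ)) r]
  | .getstack s r => [.getstack s.typ (slotOfs F s) r]
  | .setstack _ (.incoming _ _) => []
  | .setstack r s => [.setstack r s.typ (slotOfs F s)]
  | .op o args res => [.op (transfOp F o) args res]
  | .load κ m args dst => [.load κ (transfMode F m) args dst]
  | .store κ m args src => [.store κ (transfMode F m) args src]
  | .call sig f => [.call sig f]
  | .tailcall sig f => restoreCode F ++ [.tailcall sig f]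
  | .cond c args l => [.cond c args l]
  | .goto l => [.goto l]
  | .label l => [.label l]
  | .ret => restoreCode F ++ [.ret]

/-- Fails if the frame part of the activation record is bigger than `2^31` bytes. -/
def transfFn (F : Linear.Fn) : Option Mach.Fn :=
  if frameSize F ≤ 2 ^ 31 then
    some
      { sig := F.sig
        stackHigh := F.stacksize
        stackLow := -(frameSize F : ℤ)
        retaddr := ofsRetaddr
        link := ofsLink
        code := saveCode F ++ F.code.flatMap (transfInstr F) }
  else none

def transf (P : Program Linear.Fn) : Option (Program Mach.Fn) := transfProgram transfFn P

end Stacking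

end Compcert

/-! Linear keeps slots in an immaterial map, while Mach keeps them in memory, next to data that the
program can address. The alternate semantics cuts this difficulty in two.

From Linear to the alternate semantics the memories stay equal, since both allocate only the stack
data, and everything turns on slots and callee-save registers. The invariant `FrameAgree` of an
activation says that slots agree with their places in the frame, that the save places hold the
caller's values of the saved registers, and that the other callee-save registers still have the
caller's values, because the function never mentions them. Slots overlap exactly when their byte
ranges meet (`overlap_iff_bytesMeet`), so the overlap-aware updates on both sides correspond; save
places meet neither slots nor one another. Hence the restoring code recomputes the registers that
`exitfun` prescribes (`FrameAgree.regs_restore`). Incoming slots are read-only, so they stay equal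
to the caller's outgoing area, which is not modified during the call. The cases are assembled in
`plus_of_step`.

From the alternate to the standard semantics, the block of a record grows from `[0, high)` to `[low,
high)`. A program store must succeed in the alternate memory, so it never reaches the negative
offsets where the frame lies (`FrameMatch.store`); conversely, frame accesses become memory accesses
there, invisible in the alternate memory (`FrameMatch.setFrame`, `Mem.Agree.store_right`). A value
survives the round trip through memory only if it has the type of its position, which is why subject
reduction (`wtState_of_altStep`) is needed. The result is the lock-step simulation
`step_of_altStep`.

A lock-step simulation on an invariant that the source preserves is a plus simulation, and plus
simulations transport convergence and divergence. Applying this to the two halves in turn gives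
semantic preservation. -/

namespace Compcert

/-! ### Finite and infinite executions of transition systems. -/

namespace LTS

variable {L : LTS}

theorem Star.append {S S' S'' : L.State} {t₁ t₂ : Trace} (h₁ : L.Star S t₁ S')
    (h₂ : L.Star S' t₂ S'') : L.Star S (t₁ ++ t₂) S'' := by
  induction h₁ with
  | refl => simpa using h₂
  | trans hs _ ih => rw [List.append_assoc]; exact .trans hs (ih h₂)

theorem Plus.star {S S' : L.State} {t : Trace} (h : L.Plus S t S') : L.Star S t S' := by
  obtain ⟨hs, hr⟩ := h
  exact .trans hs hr

theorem Plus.one {S S' : L.State} {t : Trace} (h : L.step S t S') : L.Plus S t S' := by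
  simpa using Plus.intro h (.refl S')

theorem Star.one {S S' : L.State} {t : Trace} (h : L.step S t S') : L.Star S t S' :=
  (Plus.one h).star

/-- A silent execution followed by a step. -/
theorem Star.plus_of_step {S S' S'' : L.State} {t : Trace} (h : L.Star S [] S')
    (hs : L.step S' t S'') : L.Plus S t S'' := by
  -- The trace is made a variable so that the execution can be analysed; an empty concatenation then
  -- has two empty parts.
  generalize ht : ([] : Trace) = t₀ at h
  cases h with
  | refl => exact .one hs
  | trans h₁ h₂ =>
    obtain ⟨rfl, rfl⟩ := List.append_eq_nil_iff.1 ht.symm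
    exact Plus.intro h₁ (h₂.append (.one hs))

/-- The predicate that witnesses divergence from `S` also witnesses it from the successor, so the
greatest fixpoint can be unfolded once. -/
theorem Forever.unfold {S : L.State} {T : InfTrace} (h : L.Forever S T) :
    ∃ t S' T', L.step S t S' ∧ L.Forever S' T' ∧ T = (Stream'.Seq.ofList t).append T' := by
  obtain ⟨X, hX, hstep⟩ := h
  obtain ⟨t, S', T', h₁, h₂, h₃⟩ := hstep S T hX
  exact ⟨t, S', T', h₁, ⟨X, h₂, hstep⟩, h₃⟩

end LTS

theorem append_ofList_append (t₁ t₂ : Trace) (T : InfTrace) :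
    (Stream'.Seq.ofList (t₁ ++ t₂)).append T =
      (Stream'.Seq.ofList t₁).append ((Stream'.Seq.ofList t₂).append T) := by
  rw [Stream'.Seq.ofList_append, Stream'.Seq.append_assoc]

/-! ### Forward simulations and preservation of behaviors. -/

section Simulation

variable {L₁ L₂ : LTS} {R : L₁.State → L₂.State → Prop}

theorem PlusSimulation.star (h : PlusSimulation L₁ L₂ R) {S₁ S₁' : L₁.State} {t : Trace}
    (hs : L₁.Star S₁ t S₁') (S₂ : L₂.State) (hR : R S₁ S₂) :
    ∃ S₂', L₂.Star S₂ t S₂' ∧ R S₁' S₂' := by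
  induction hs generalizing S₂ with
  | refl => exact ⟨S₂, .refl _, hR⟩
  | trans hs _ ih =>
    obtain ⟨S₂', hp, hR'⟩ := h.plus _ _ _ _ hR hs
    obtain ⟨S₂'', hs', hR''⟩ := ih _ hR'
    exact ⟨S₂'', hp.star.append hs', hR''⟩

/-- Divergence asks for a predicate closed under single target transitions, while one source
transition is matched by several. The predicate therefore carries a finite execution still to be
performed. When it is used up, the next source transition supplies a new one; "plus" instead of
"star" guarantees that the target really moves. -/
theorem PlusSimulation.forever (h : PlusSimulation L₁ L₂ R) {S₁ : L₁.State} {S₂ : L₂.State}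
    {T : InfTrace} (hf : L₁.Forever S₁ T) (hR : R S₁ S₂) : L₂.Forever S₂ T := by
  refine ⟨fun S T => ∃ t S₁ S₂ T', L₂.Star S t S₂ ∧ R S₁ S₂ ∧ L₁.Forever S₁ T' ∧
    T = (Stream'.Seq.ofList t).append T', ⟨[], S₁, S₂, T, .refl _, hR, hf, by simp⟩, ?_⟩
  rintro S T ⟨t, S₁, S₂, T', hs, hR, hf, rfl⟩
  cases hs with
  | refl =>
    obtain ⟨t, S₁', T'', hstep, hf', rfl⟩ := hf.unfold
    obtain ⟨S₂', hp, hR'⟩ := h.plus _ _ _ _ hR hstep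
    obtain ⟨h₁, h₂⟩ := hp
    exact ⟨_, _, _, h₁, ⟨_, _, _, _, h₂, hR', hf', rfl⟩, by simp⟩
  | trans h₁ h₂ =>
    exact ⟨_, _, _, h₁, ⟨_, _, _, _, h₂, hR, hf, rfl⟩, append_ofList_append _ _ _⟩

theorem PlusSimulation.behaves (h : PlusSimulation L₁ L₂ R) {B : Behavior} (hB : ¬ B.Wrong)
    (hb : L₁.Behaves B) : L₂.Behaves B := by
  cases hb with
  | converges hi hs hf =>
    obtain ⟨S₂, hi₂⟩ := h.initial_exists _ hi
    obtain ⟨S₂', hs₂, hR⟩ := h.star hs S₂ (h.initial _ _ hi hi₂)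
    exact .converges hi₂ hs₂ (h.final _ _ _ hR hf)
  | diverges hi hf =>
    obtain ⟨S₂, hi₂⟩ := h.initial_exists _ hi
    exact .diverges hi₂ (h.forever hf (h.initial _ _ hi hi₂))
  | goeswrong => exact absurd ⟨_, rfl⟩ hB

/-- The invariant becomes a conjunct of the relation, which removes the restriction on source
states. -/
theorem LockStepSimulationOn.plusSimulation {I : L₁.State → Prop}
    (h : LockStepSimulationOn L₁ L₂ I R) (hinit : ∀ S, L₁.initial S → I S)
    (hstep : ∀ S t S', L₁.step S t S' → I S → I S') :
    PlusSimulation L₁ L₂ fun S₁ S₂ => I S₁ ∧ R S₁ S₂ where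
  initial_exists := h.initial_exists
  initial S₁ S₂ h₁ h₂ := ⟨hinit S₁ h₁, h.initial S₁ S₂ h₁ h₂⟩
  final S₁ S₂ n hR := h.final S₁ S₂ n hR.2
  plus S₁ S₂ t S₁' hR hs := by
    obtain ⟨S₂', hs₂, hR'⟩ := h.lockstep S₁ S₂ t S₁' hR.1 hR.2 hs
    exact ⟨S₂', .one hs₂, hstep _ _ _ hs hR.1, hR'⟩

end Simulation

/-! ### Global environments -/

theorem mem_functs_of_funct {F : Type} {P : Program F} {b : Block} {fd : FunDef F}
    (h : (globalenv P).funct b = some fd) : ∃ id, (id, fd) ∈ P.functs := by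
  simp only [globalenv] at h
  split at h
  · obtain ⟨⟨id, fd'⟩, hd, rfl⟩ := Option.map_eq_some_iff.1 h
    exact ⟨id, List.mem_of_getElem? hd⟩
  · simp at h

theorem mem_functs_of_findFunction {F : Type} {P : Program F} {rs : MReg → Val} {f : FunRef}
    {fd : FunDef F} (h : findFunction (globalenv P) rs f = some fd) :
    ∃ id, (id, fd) ∈ P.functs := by
  cases f with
  | reg r =>
    simp only [findFunction] at h
    split at h
    · split at h
      · exact mem_functs_of_funct h
      · simp at h
    · simp at h
  | sym id =>
    obtain ⟨b, -, hb⟩ := Option.bind_eq_some_iff.1 h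
    exact mem_functs_of_funct hb

/-! ### Typing of values -/

/-- Values that do not fit the quantity become `undef`, which has every type. Loads are thus well
typed whatever memory contains, and no typing invariant on memory is needed. -/
theorem hasType_cast (κ : Chunk) (v : Val) : (cast κ v).HasType κ.typ := by
  cases κ <;> cases v <;> simp [cast, Val.HasType, Chunk.typ]

theorem hasType_load {M : Mem} {κ : Chunk} {b : Block} {δ : ℤ} {v : Val}
    (h : M.load κ b δ = some v) : v.HasType κ.typ := by
  unfold Mem.load at h
  split at h
  · cases h; exact hasType_cast _ _
  · simp at h

/-- `move` is polymorphic, and the entry of `Op.typ` for it is only a placeholder; it is treated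
apart in `hasType_evalOp_regs`. -/
theorem hasType_evalOp {F : Type} {G : GEnv F} {sp : Val} {o : Op} {vs : List Val} {v : Val}
    (ho : o ≠ .move) (h : evalOp G sp o vs = some v) : v.HasType o.typ.2 := by
  unfold evalOp at h
  split at h <;>
    first
    | exact absurd rfl ho
    | (cases h; exact rfl)
    | cases h
    | (simp only [symbolAddr, Option.map_eq_some_iff] at h; obtain ⟨_, _, rfl⟩ := h; exact rfl)
    | (split at h <;> simp at h; subst h; exact rfl)
    | skip
  -- The remaining operator is `addrstack`; when it succeeds, its result is a pointer.
  · unfold Val.addOfs at h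
    split at h
    · cases h; rfl
    · simp at h

theorem hasType_extCall {fe : ExtFun} {vs : List Val} {t : Trace} {v : Val}
    (h : ExtCall fe vs t v) : v.HasType (locResult fe.sig).typ := by
  obtain ⟨_, e, -, rfl, -, he, -⟩ := h
  have : (locResult fe.sig).typ = fe.sig.resTyp := by
    unfold locResult
    split <;> rename_i h <;> rw [h] <;> rfl
  rw [this, ← he]
  cases e <;> rfl

/-! ### The type system of Mach and subject reduction. -/

namespace Mach

theorem findLabel_suffix {l : Label} {c c' : Code} (h : findLabel l c = some c') : c' <:+ c := by
  induction c with
  | nil => simp [findLabel] at h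
  | cons i c ih =>
    unfold findLabel at h
    split at h
    · simp at h
    · rename_i heq
      cases heq
      split at h
      · cases h; exact List.suffix_rfl
      · exact (ih h).trans (List.suffix_cons _ _)
    · rename_i heq
      cases heq
      exact (ih h).trans (List.suffix_cons _ _)

theorem WTCode.of_suffix {c c' : Code} (h : WTCode c) (hs : c' <:+ c) : WTCode c' :=
  fun i hi => h i (hs.subset hi)

theorem WTCode.tail {i : Instr} {c : Code} (h : WTCode (i :: c)) : WTCode c :=
  h.of_suffix (List.suffix_cons _ _)

theorem WTRegs.set {R : RegMap} (h : WTRegs R) {r : MReg} {v : Val} (hv : v.HasType r.typ) :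
    WTRegs (R.set r v) := by
  intro r'
  by_cases e : r' = r
  · subst e; simpa [RegMap.set] using hv
  · simpa [RegMap.set, e] using h r'

theorem WTFrameEnv.set {Φ : FrameEnv} (h : WTFrameEnv Φ) {τ : Typ} {δ : ℤ} {v : Val}
    (hv : v.HasType τ) : WTFrameEnv (Φ.set τ δ v) := by
  intro τ' δ'
  unfold FrameEnv.set
  split_ifs with h₁ h₂
  · rw [← h₁.1]; exact hv
  · trivial
  · exact h _ _

theorem setFrame_eq_some {F : Fn} {Φ Φ' : FrameEnv} {τ : Typ} {δ : ℤ} {v : Val} :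
    setFrame F Φ τ δ v = some Φ' ↔ SlotValid F τ δ ∧ Φ.set τ δ v = Φ' := by
  unfold setFrame; split_ifs <;> simp_all

theorem getFrame_eq_some {F : Fn} {Φ : FrameEnv} {τ : Typ} {δ : ℤ} {v : Val} :
    getFrame F Φ τ δ = some v ↔ SlotValid F τ δ ∧ Φ τ δ = v := by
  unfold getFrame; split_ifs <;> simp_all

theorem getParentFrame_eq_some {stk : List AltFrame} {τ : Typ} {δ : ℤ} {v : Val} :
    getParentFrame stk τ δ = some v ↔
      ∃ fr stk', stk = fr :: stk' ∧ SlotValid fr.fn τ δ ∧ fr.Φ τ δ = v := by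
  cases stk <;> simp [getParentFrame, getFrame_eq_some]

theorem hasType_evalOp_regs {F : Type} {G : GEnv F} {sp : Val} {o : Op} {args : List MReg}
    {res : MReg} {R : RegMap} {v : Val} (hR : WTRegs R) (hwt : WTOp o args res)
    (h : evalOp G sp o (args.map R) = some v) : v.HasType res.typ := by
  rcases hwt with ⟨rfl, r, rfl, hr⟩ | ⟨ho, ht⟩
  · simp only [List.map_cons, List.map_nil, evalOp, Option.some.injEq] at h
    rw [← hr, ← h]; exact hR r
  · have := hasType_evalOp ho h
    rwa [← ht] at this

theorem WTProgram.of_funct {Q : Program Fn} (hQ : WTProgram Q) {b : Block} {fd : FunDef Fn}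
    (h : (globalenv Q).funct b = some fd) : WTFunDef fd :=
  let ⟨id, hid⟩ := mem_functs_of_funct h
  hQ id fd hid

theorem WTProgram.of_findFunction {Q : Program Fn} (hQ : WTProgram Q) {rs : MReg → Val}
    {f : FunRef} {fd : FunDef Fn} (h : findFunction (globalenv Q) rs f = some fd) : WTFunDef fd :=
  let ⟨id, hid⟩ := mem_functs_of_findFunction h
  hQ id fd hid

theorem wtState_of_altInitial {Q : Program Fn} (hQ : WTProgram Q) {S : AltState}
    (h : AltInitial Q S) : WTState S := by
  obtain ⟨-, hfd, -⟩ := h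
  exact ⟨fun _ h => by simp at h, hQ.of_funct hfd, fun _ => trivial⟩

/-- Subject reduction for the alternate semantics. -/
theorem wtState_of_altStep {Q : Program Fn} (hQ : WTProgram Q) {S S' : AltState} {t : Trace}
    (h : AltStep (globalenv Q) S t S') (hS : WTState S) : WTState S' := by
  cases h with
  | setstack h =>
    obtain ⟨hstk, hF, hc, hR, hΦ⟩ := hS
    obtain ⟨-, rfl⟩ := setFrame_eq_some.1 h
    -- The typing rule of the current instruction, unfolded to the equality between the class of the
    -- register and the type of the frame position.
    have : _ = _ := hc _ List.mem_cons_self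
    exact ⟨hstk, hF, hc.tail, hR, hΦ.set (this ▸ hR _)⟩
  | getstack h =>
    obtain ⟨hstk, hF, hc, hR, hΦ⟩ := hS
    obtain ⟨-, rfl⟩ := getFrame_eq_some.1 h
    have : _ = _ := hc _ List.mem_cons_self
    exact ⟨hstk, hF, hc.tail, hR.set (this ▸ hΦ _ _), hΦ⟩
  | getparent h =>
    obtain ⟨hstk, hF, hc, hR, hΦ⟩ := hS
    obtain ⟨fr, stk', rfl, -, rfl⟩ := getParentFrame_eq_some.1 h
    have : _ = _ := hc _ List.mem_cons_self
    exact ⟨hstk, hF, hc.tail, hR.set (this ▸ (hstk fr List.mem_cons_self).2.2 _ _), hΦ⟩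
  | op h =>
    obtain ⟨hstk, hF, hc, hR, hΦ⟩ := hS
    exact ⟨hstk, hF, hc.tail, hR.set (hasType_evalOp_regs hR (hc _ List.mem_cons_self) h), hΦ⟩
  | load _ h =>
    obtain ⟨hstk, hF, hc, hR, hΦ⟩ := hS
    have : _ ∧ _ = _ := hc _ List.mem_cons_self
    exact ⟨hstk, hF, hc.tail, hR.set (this.2 ▸ hasType_load h), hΦ⟩
  | store | cond_false | label =>
    obtain ⟨hstk, hF, hc, hR, hΦ⟩ := hS
    exact ⟨hstk, hF, hc.tail, hR, hΦ⟩
  | call h =>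
    obtain ⟨hstk, hF, hc, hR, hΦ⟩ := hS
    exact ⟨List.forall_mem_cons.2 ⟨⟨hF, hc.tail, hΦ⟩, hstk⟩, hQ.of_findFunction h, hR⟩
  | tailcall h =>
    obtain ⟨hstk, hF, hc, hR, hΦ⟩ := hS
    exact ⟨hstk, hQ.of_findFunction h, hR⟩
  -- A jump may land anywhere in the function, so typing of the remaining code is not enough: the
  -- whole body has to be known well typed.
  | cond_true _ h | goto h =>
    obtain ⟨hstk, hF, hc, hR, hΦ⟩ := hS
    exact ⟨hstk, hF, hF.code.of_suffix (findLabel_suffix h), hR, hΦ⟩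
  | ret =>
    obtain ⟨hstk, hF, hc, hR, hΦ⟩ := hS
    exact ⟨hstk, hR⟩
  | internal =>
    obtain ⟨hstk, hF, hR⟩ := hS
    exact ⟨hstk, hF, hF.code, hR, fun _ _ => trivial⟩
  | external _ h =>
    obtain ⟨hstk, hF, hR⟩ := hS
    exact ⟨hstk, hR.set (hasType_extCall h)⟩
  | resume =>
    obtain ⟨hstk, hR⟩ := hS
    obtain ⟨⟨hF, hc, hΦ⟩, hstk⟩ := List.forall_mem_cons.1 hstk
    exact ⟨hstk, hF, hc, hR, hΦ⟩

end Mach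

/-! ### Memory -/

theorem Chunk.size_pos (κ : Chunk) : 0 < κ.size := by cases κ <;> decide

theorem Typ.size_pos (τ : Typ) : 0 < τ.size := by cases τ <;> decide

theorem Typ.size_chunk (τ : Typ) : (τ.chunk.size : ℤ) = τ.size := by cases τ <;> rfl

theorem cast_chunk {v : Val} {τ : Typ} (h : v.HasType τ) : cast τ.chunk v = v := by
  cases τ <;> cases v <;> simp_all [cast, Val.HasType, Typ.chunk]

namespace Mem

theorem getN_congr {c c' : ℤ → Content} {n : ℕ} {δ : ℤ} (hn : 0 < n)
    (h : ∀ x, δ ≤ x → x < δ + n → c x = c' x) : getN c n δ = getN c' n δ := by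
  have h₁ : c δ = c' δ := h δ le_rfl (by omega)
  have h₂ : ((List.range (n - 1)).all fun i => decide (c (δ + 1 + i) = .cont)) =
      (List.range (n - 1)).all fun i => decide (c' (δ + 1 + i) = .cont) := by
    rw [Bool.eq_iff_iff]
    simp only [List.all_eq_true, List.mem_range, decide_eq_true_eq]
    refine forall₂_congr fun i hi => ?_
    rw [h _ (by omega) (by omega)]
  unfold getN
  rw [h₁, h₂]

theorem getN_setN_same (c : ℤ → Content) {n : ℕ} (δ : ℤ) (v : Val) :
    getN (setN c n δ v) n δ = v := by
  have h₂ : ((List.range (n - 1)).all fun i =>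
      decide (setN c n δ v (δ + 1 + i) = .cont)) = true := by
    simp only [List.all_eq_true, List.mem_range, decide_eq_true_eq]
    intro i hi
    simp only [setN]
    rw [if_neg (by omega), if_pos (by omega)]
  simp only [getN, h₂]
  simp [setN]

theorem getN_setN_disjoint (c : ℤ → Content) {n m : ℕ} {δ δ' : ℤ} (v : Val) (hm : 0 < m)
    (hn : 0 < n) (h : δ' + m ≤ δ ∨ δ + n ≤ δ') :
    getN (setN c n δ v) m δ' = getN c m δ' := by
  refine getN_congr hm fun x h₁ h₂ => ?_
  simp only [setN]
  rw [if_neg (by omega), if_neg (by omega)]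

/-- A read that starts before the write meets the head byte of the new datum where a continuation
byte is required; one that starts at the same place finds the wrong size; one that starts later
finds a continuation byte instead of a head. -/
theorem getN_setN_overlap (c : ℤ → Content) {n m : ℕ} {δ δ' : ℤ} (v : Val)
    (hne : ¬ (δ = δ' ∧ n = m)) (h₁ : δ < δ' + m) (h₂ : δ' < δ + n) :
    getN (setN c n δ v) m δ' = .undef := by
  rcases lt_trichotomy δ' δ with hlt | rfl | hlt
  · have h₃ : ((List.range (m - 1)).all fun i =>
        decide (setN c n δ v (δ' + 1 + i) = .cont)) = false := by
      rw [List.all_eq_false]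
      -- Continuation bytes are counted from `δ' + 1`, so this index designates the byte at `δ`.
      refine ⟨(δ - δ' - 1).toNat, List.mem_range.2 (by omega), ?_⟩
      have : δ' + 1 + ((δ - δ' - 1).toNat : ℤ) = δ := by omega
      rw [this]
      simp [setN]
    simp only [getN, h₃]
    split <;> simp
  · simp only [true_and] at hne
    simp [getN, setN, hne]
  · have : setN c n δ v δ' = .cont := by
      simp only [setN]
      rw [if_neg (by omega), if_pos (by omega)]
    simp [getN, this]

theorem load_eq_some {M : Mem} {κ : Chunk} {b : Block} {δ : ℤ} {v : Val} :
    M.load κ b δ = some v ↔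
      M.InBounds κ b δ ∧ cast κ (getN (M.blocks b).contents κ.size δ) = v := by
  unfold load; split_ifs <;> simp_all

theorem store_eq_some {M M' : Mem} {κ : Chunk} {b : Block} {δ : ℤ} {v : Val} :
    M.store κ b δ v = some M' ↔ M.InBounds κ b δ ∧
      (⟨Function.update M.blocks b
        { M.blocks b with contents := setN (M.blocks b).contents κ.size δ v }, M.next⟩ : Mem) =
        M' := by
  unfold store; split_ifs <;> simp_all

theorem blocks_store {M M' : Mem} {κ : Chunk} {b : Block} {δ : ℤ} {v : Val}
    (h : M.store κ b δ v = some M') :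
    M'.blocks b = { M.blocks b with contents := setN (M.blocks b).contents κ.size δ v } := by
  obtain ⟨-, rfl⟩ := store_eq_some.1 h
  exact Function.update_self ..

theorem blocks_store_of_ne {M M' : Mem} {κ : Chunk} {b b' : Block} {δ : ℤ} {v : Val}
    (h : M.store κ b δ v = some M') (hb : b' ≠ b) : M'.blocks b' = M.blocks b' := by
  obtain ⟨-, rfl⟩ := store_eq_some.1 h
  exact Function.update_of_ne hb ..

theorem next_store {M M' : Mem} {κ : Chunk} {b : Block} {δ : ℤ} {v : Val}
    (h : M.store κ b δ v = some M') : M'.next = M.next := by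
  obtain ⟨-, rfl⟩ := store_eq_some.1 h
  rfl

theorem load_congr {M M' : Mem} {b : Block} (h : M.blocks b = M'.blocks b) (κ : Chunk) (δ : ℤ) :
    M.load κ b δ = M'.load κ b δ := by
  simp only [load, InBounds, h]

theorem load_store_same {M M' : Mem} {κ : Chunk} {b : Block} {δ : ℤ} {v : Val}
    (h : M.store κ b δ v = some M') : M'.load κ b δ = some (cast κ v) := by
  have hb := blocks_store h
  rw [load_eq_some, InBounds, hb]
  exact ⟨(store_eq_some.1 h).1, by rw [getN_setN_same]⟩

theorem load_store_disjoint {M M' : Mem} {κ κ' : Chunk} {b : Block} {δ δ' : ℤ} {v : Val}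
    (h : M.store κ b δ v = some M') (hd : δ' + κ'.size ≤ δ ∨ δ + κ.size ≤ δ') :
    M'.load κ' b δ' = M.load κ' b δ' := by
  simp only [load, InBounds, blocks_store h,
    getN_setN_disjoint _ _ κ'.size_pos κ.size_pos hd]

theorem cast_undef (κ : Chunk) : cast κ .undef = .undef := by cases κ <;> rfl

theorem load_store_overlap {M M' : Mem} {κ κ' : Chunk} {b : Block} {δ δ' : ℤ} {v v' : Val}
    (h : M.store κ b δ v = some M') (hl : M.load κ' b δ' = some v')
    (hne : ¬ (δ = δ' ∧ κ.size = κ'.size)) (h₁ : δ < δ' + κ'.size) (h₂ : δ' < δ + κ.size) :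
    M'.load κ' b δ' = some .undef := by
  have hb := blocks_store h
  rw [load_eq_some, InBounds, hb]
  exact ⟨(load_eq_some.1 hl).1, by rw [getN_setN_overlap _ _ hne h₁ h₂, cast_undef]⟩

/-- `B'` has larger bounds than `B`, and the same contents within the bounds of `B`. -/
def BlockExtends (B B' : BlockData) : Prop :=
  B'.lo ≤ B.lo ∧ B.hi ≤ B'.hi ∧ ∀ x, B.lo ≤ x → x < B.hi → B.contents x = B'.contents x

theorem BlockExtends.refl (B : BlockData) : BlockExtends B B :=
  ⟨le_rfl, le_rfl, fun _ _ _ => rfl⟩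

/-- A memory extension in which blocks are compared byte by byte. -/
def Agree (M M' : Mem) : Prop :=
  M.next = M'.next ∧ ∀ b, BlockExtends (M.blocks b) (M'.blocks b)

theorem Agree.refl (M : Mem) : M.Agree M := ⟨rfl, fun _ => .refl _⟩

theorem Agree.inBounds {M M' : Mem} (h : M.Agree M') {κ : Chunk} {b : Block} {δ : ℤ}
    (hb : M.InBounds κ b δ) : M'.InBounds κ b δ :=
  ⟨(h.2 b).1.trans hb.1, hb.2.trans (h.2 b).2.1⟩

/-- The invariant carried through executions is the byte-wise `Agree`, which visibly commutes with
memory operations and also fixes the next block. The load-based ordering is only extracted from it.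
-/
theorem Agree.extends {M M' : Mem} (h : M.Agree M') : M.Extends M' := by
  intro κ b δ v hl
  rw [load_eq_some] at hl ⊢
  refine ⟨h.inBounds hl.1, ?_⟩
  rw [← hl.2, getN_congr κ.size_pos fun x h₁ h₂ => ?_]
  exact ((h.2 b).2.2 x (hl.1.1.trans h₁) (h₂.trans_le hl.1.2)).symm

theorem Agree.store {M M' M₁ : Mem} (h : M.Agree M') {κ : Chunk} {b : Block} {δ : ℤ} {v : Val}
    (hs : M.store κ b δ v = some M₁) :
    ∃ M₁', M'.store κ b δ v = some M₁' ∧ M₁.Agree M₁' := by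
  have hb := (store_eq_some.1 hs).1
  obtain ⟨M₁', hs'⟩ : ∃ M₁', M'.store κ b δ v = some M₁' :=
    ⟨_, store_eq_some.2 ⟨h.inBounds hb, rfl⟩⟩
  refine ⟨M₁', hs', by rw [next_store hs, next_store hs', h.1], fun b' => ?_⟩
  by_cases e : b' = b
  · subst e
    rw [blocks_store hs, blocks_store hs']
    refine ⟨(h.2 b').1, (h.2 b').2.1, fun x h₁ h₂ => ?_⟩
    simp only [setN]
    rw [(h.2 b').2.2 x h₁ h₂]
  · rw [blocks_store_of_ne hs e, blocks_store_of_ne hs' e]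
    exact h.2 b'

/-- A store outside the bounds of the smaller memory. -/
theorem Agree.store_right {M M' M₁' : Mem} (h : M.Agree M') {κ : Chunk} {b : Block} {δ : ℤ}
    {v : Val} (hs : M'.store κ b δ v = some M₁')
    (hd : δ + κ.size ≤ (M.blocks b).lo) : M.Agree M₁' := by
  refine ⟨by rw [next_store hs, h.1], fun b' => ?_⟩
  by_cases e : b' = b
  · subst e
    rw [blocks_store hs]
    refine ⟨(h.2 b').1, (h.2 b').2.1, fun x h₁ h₂ => ?_⟩
    have := κ.size_pos
    simp only [setN]
    rw [if_neg (by omega), if_neg (by omega)]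
    exact (h.2 b').2.2 x h₁ h₂
  · rw [blocks_store_of_ne hs e]
    exact h.2 b'

theorem Agree.free {M M' : Mem} (h : M.Agree M') (b : Block) : (M.free b).Agree (M'.free b) := by
  refine ⟨h.1, fun b' => ?_⟩
  by_cases e : b' = b
  · subst e; simp [Mem.free, BlockExtends.refl]
  · simpa [Mem.free, e] using h.2 b'

/-- The standard semantics allocates the frame part below the stack data; lowering the bottom of a
fresh block only enlarges it. -/
theorem Agree.alloc {M M' : Mem} (h : M.Agree M') {l l' : ℤ} (u : ℤ) (hl : l' ≤ l) :
    (M.alloc l u).2.Agree (M'.alloc l' u).2 := by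
  refine ⟨by simp [Mem.alloc, h.1], fun b' => ?_⟩
  by_cases e : b' = M.next
  · subst e
    simp only [Mem.alloc, ← h.1, Function.update_self]
    exact ⟨hl, le_rfl, fun _ _ _ => rfl⟩
  · simpa [Mem.alloc, ← h.1, e] using h.2 b'

theorem blocks_free_of_ne {M : Mem} {b b' : Block} (h : b' ≠ b) :
    (M.free b).blocks b' = M.blocks b' := Function.update_of_ne h ..

theorem blocks_alloc_of_ne {M : Mem} {l u : ℤ} {b' : Block} (h : b' ≠ M.next) :
    (M.alloc l u).2.blocks b' = M.blocks b' := Function.update_of_ne h ..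

theorem blocks_alloc {M : Mem} {l u : ℤ} :
    (M.alloc l u).2.blocks M.next = ⟨l, u, fun _ => .undef⟩ := Function.update_self ..

theorem load_alloc {M : Mem} {l u : ℤ} {κ : Chunk} {δ : ℤ} (h₁ : l ≤ δ) (h₂ : δ + κ.size ≤ u) :
    (M.alloc l u).2.load κ M.next δ = some .undef := by
  rw [load_eq_some, InBounds, blocks_alloc]
  exact ⟨⟨h₁, h₂⟩, by simp [getN, cast_undef]⟩

end Mem

/-! ### From the alternate to the standard semantics -/

namespace Mach

/-- The machine addition is modulo `2^32`, but the exact sum is in the signed range and so is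
recovered. Only the sum has to fit: with a frame part of maximal size, `δ` may itself be `2^31`. -/
theorem toInt_frameOfs {l δ : ℤ} (hl : -(2 ^ 31) ≤ l) (h₀ : 0 ≤ δ) (h : l + δ < 2 ^ 31) :
    (BitVec.ofInt 32 l + BitVec.ofInt 32 δ).toInt = l + δ := by
  rw [← BitVec.ofInt_add, BitVec.toInt_ofInt]
  apply Int.bmod_eq_of_le <;> omega

theorem loadstack_stackPtr {F : Fn} (hF : WTFn F) {τ : Typ} {M : Mem} {b : Block} {δ : ℤ}
    (h₀ : 0 ≤ δ) (h : δ ≤ -F.stackLow) :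
    loadstack τ M (stackPtr F b) δ = M.load τ.chunk b (F.stackLow + δ) := by
  simp only [loadstack, stackPtr]
  rw [toInt_frameOfs hF.low.1 h₀ (by omega)]

theorem storestack_stackPtr {F : Fn} (hF : WTFn F) {τ : Typ} {M : Mem} {b : Block} {δ : ℤ}
    {v : Val} (h₀ : 0 ≤ δ) (h : δ ≤ -F.stackLow) :
    storestack τ M (stackPtr F b) δ v = M.store τ.chunk b (F.stackLow + δ) v := by
  simp only [storestack, stackPtr]
  rw [toInt_frameOfs hF.low.1 h₀ (by omega)]

/-- The activation record at block `b` in the memory `M'` of the standard semantics represents the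
abstract frame `Φ`, with the given back link and return address; the memory `M` of the
alternate semantics only has the stack data of the record. -/
structure FrameMatch (M M' : Mem) (F : Fn) (b : Block) (Φ : FrameEnv) (link ra : Val) : Prop where
  lo : 0 ≤ (M.blocks b).lo
  lo' : (M'.blocks b).lo = F.stackLow
  hi' : (M'.blocks b).hi = F.stackHigh
  slot : ∀ τ δ, SlotValid F τ δ → M'.load τ.chunk b (F.stackLow + δ) = some (Φ τ δ)
  link : M'.load .int32 b (F.stackLow + F.link) = some link
  ra : M'.load .int32 b (F.stackLow + F.retaddr) = some ra

theorem FrameMatch.congr {M M' M₁ M₁' : Mem} {F : Fn} {b : Block} {Φ : FrameEnv} {l r : Val}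
    (h : FrameMatch M M' F b Φ l r) (h₁ : M₁.blocks b = M.blocks b)
    (h₂ : M₁'.blocks b = M'.blocks b) : FrameMatch M₁ M₁' F b Φ l r where
  lo := h₁ ▸ h.lo
  lo' := h₂ ▸ h.lo'
  hi' := h₂ ▸ h.hi'
  slot τ δ hv := by rw [Mem.load_congr h₂]; exact h.slot τ δ hv
  link := by rw [Mem.load_congr h₂]; exact h.link
  ra := by rw [Mem.load_congr h₂]; exact h.ra

/-- A store by the program succeeds in the alternate memory, hence lies at a nonnegative offset of
its block; the slots, the link and the return address all end at or below offset 0. -/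
theorem FrameMatch.store {M M' M₁ M₁' : Mem} {F : Fn} (hF : WTFn F) {b b' : Block} {Φ : FrameEnv}
    {l r v : Val} {κ : Chunk} {δ : ℤ} (h : FrameMatch M M' F b Φ l r)
    (hs : M.store κ b' δ v = some M₁) (hs' : M'.store κ b' δ v = some M₁') :
    FrameMatch M₁ M₁' F b Φ l r := by
  by_cases e : b = b'
  · subst e
    have hb : 0 ≤ δ := h.lo.trans (Mem.store_eq_some.1 hs).1.1
    have hl := hF.link
    have hr := hF.retaddr
    refine ⟨by rw [Mem.blocks_store hs]; exact h.lo, by rw [Mem.blocks_store hs']; exact h.lo',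
      by rw [Mem.blocks_store hs']; exact h.hi', fun τ δ' hv => ?_, ?_, ?_⟩
    · rw [Mem.load_store_disjoint hs', h.slot τ δ' hv]
      have := hv.2.1
      rw [Typ.size_chunk]; omega
    · rw [Mem.load_store_disjoint hs', h.link]; simp only [Chunk.size]; omega
    · rw [Mem.load_store_disjoint hs', h.ra]; simp only [Chunk.size]; omega
  · exact h.congr (Mem.blocks_store_of_ne hs e) (Mem.blocks_store_of_ne hs' e)

/-- `FrameEnv.set` imitates a memory store: the same position reads back the value (`cast` is the
identity on values of the right type), overlapping positions become `undef`, and disjoint ones are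
unchanged. `SlotValid` protects the two reserved places. -/
theorem FrameMatch.setFrame {M M' M₁' : Mem} {F : Fn} {b : Block} {Φ : FrameEnv}
    {l r v : Val} {τ : Typ} {δ : ℤ} (h : FrameMatch M M' F b Φ l r) (hv : v.HasType τ)
    (hδ : SlotValid F τ δ) (hs : M'.store τ.chunk b (F.stackLow + δ) v = some M₁') :
    FrameMatch M M₁' F b (Φ.set τ δ v) l r := by
  obtain ⟨h₀, h₁, h₂, h₃⟩ := hδ
  refine ⟨h.lo, by rw [Mem.blocks_store hs]; exact h.lo',
    by rw [Mem.blocks_store hs]; exact h.hi', fun τ' δ' hv' => ?_, ?_, ?_⟩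
  · unfold FrameEnv.set
    split_ifs with e₁ e₂
    · obtain ⟨rfl, rfl⟩ := e₁
      rw [Mem.load_store_same hs, cast_chunk hv]
    · refine Mem.load_store_overlap hs (h.slot τ' δ' hv') ?_ ?_ ?_
      · rintro ⟨h₁, h₂⟩
        refine e₁ ⟨?_, by omega⟩
        -- The two types have different sizes, so equal sizes mean equal types.
        cases τ <;> cases τ' <;> first | rfl | cases h₂
      · rw [Typ.size_chunk]; omega
      · rw [Typ.size_chunk]; omega
    · rw [Mem.load_store_disjoint hs, h.slot τ' δ' hv']
      rw [Typ.size_chunk, Typ.size_chunk]; omega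
  · rw [Mem.load_store_disjoint hs, h.link]
    rw [Typ.size_chunk]; simp only [Chunk.size]; omega
  · rw [Mem.load_store_disjoint hs, h.ra]
    rw [Typ.size_chunk]; simp only [Chunk.size]; omega

/-- The function is an internal function of the program. -/
def IsFn (Q : Program Fn) (F : Fn) : Prop := ∃ id, (id, FunDef.internal F) ∈ Q.functs

theorem IsFn.wtFn {Q : Program Fn} {F : Fn} (h : IsFn Q F) (hQ : WTProgram Q) : WTFn F :=
  let ⟨id, hid⟩ := h
  hQ id _ hid

/-- The blocks of the frames decrease from the bound `n`. -/
inductive StackMatch (Q : Program Fn) (M M' : Mem) :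
    Block → List AltFrame → List Frame → Prop
  | nil {n} : StackMatch Q M M' n [] []
  | cons {n F b c Φ b' δ' stk stk'} :
      IsFn Q F → c <:+ F.code → b < n →
      FrameMatch M M' F b Φ (parentSp stk') (parentRa stk') →
      StackMatch Q M M' b stk stk' →
      StackMatch Q M M' n (⟨F, stackPtr F b, c, Φ⟩ :: stk)
        (⟨F, stackPtr F b, .ptr b' δ', c⟩ :: stk')

theorem StackMatch.mono {Q : Program Fn} {M M' : Mem} {n n' : Block} {stk : List AltFrame}
    {stk' : List Frame} (h : StackMatch Q M M' n stk stk') (hn : n ≤ n') :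
    StackMatch Q M M' n' stk stk' := by
  cases h with
  | nil => exact .nil
  | cons h₁ h₂ h₃ h₄ h₅ => exact .cons h₁ h₂ (h₃.trans_le hn) h₄ h₅

theorem StackMatch.map {Q : Program Fn} {M M' M₁ M₁' : Mem} {n : Block} {stk : List AltFrame}
    {stk' : List Frame} (h : StackMatch Q M M' n stk stk')
    (hm : ∀ b < n, ∀ F Φ l r, IsFn Q F → FrameMatch M M' F b Φ l r →
      FrameMatch M₁ M₁' F b Φ l r) : StackMatch Q M₁ M₁' n stk stk' := by
  induction h with
  | nil => exact .nil
  | cons h₁ h₂ h₃ h₄ _ ih =>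
    exact .cons h₁ h₂ h₃ (hm _ h₃ _ _ _ _ h₁ h₄) (ih fun b hb => hm b (hb.trans h₃))

/-- All blocks of the stack lie below the bound. Writing into or freeing the current record, or
allocating a new one, acts at or above it, and therefore leaves the callers' frames alone. -/
theorem StackMatch.congr {Q : Program Fn} {M M' M₁ M₁' : Mem} {n : Block} {stk : List AltFrame}
    {stk' : List Frame} (h : StackMatch Q M M' n stk stk')
    (h₁ : ∀ b < n, M₁.blocks b = M.blocks b) (h₂ : ∀ b < n, M₁'.blocks b = M'.blocks b) :
    StackMatch Q M₁ M₁' n stk stk' :=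
  h.map fun b hb _ _ _ _ _ hm => hm.congr (h₁ b hb) (h₂ b hb)

/-- The value is a pointer or, at the bottom of the stack, the null integer; in both cases it
survives being stored as a link. -/
theorem StackMatch.hasType_parentSp {Q : Program Fn} {M M' : Mem} {n : Block}
    {stk : List AltFrame} {stk' : List Frame} (h : StackMatch Q M M' n stk stk') :
    (parentSp stk').HasType .int := by
  cases h <;> rfl

theorem StackMatch.hasType_parentRa {Q : Program Fn} {M M' : Mem} {n : Block}
    {stk : List AltFrame} {stk' : List Frame} (h : StackMatch Q M M' n stk stk') :
    (parentRa stk').HasType .int := by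
  cases h <;> rfl

theorem FrameMatch.loadstack_slot {M M' : Mem} {F : Fn} (hF : WTFn F) {b : Block} {Φ : FrameEnv}
    {l r : Val} (h : FrameMatch M M' F b Φ l r) {τ : Typ} {δ : ℤ} (hv : SlotValid F τ δ) :
    loadstack τ M' (stackPtr F b) δ = some (Φ τ δ) := by
  have := Typ.size_pos τ
  have := hv.2.1
  rw [loadstack_stackPtr hF hv.1 (by omega), h.slot τ δ hv]

theorem FrameMatch.loadstack_link {M M' : Mem} {F : Fn} (hF : WTFn F) {b : Block} {Φ : FrameEnv}
    {l r : Val} (h : FrameMatch M M' F b Φ l r) :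
    loadstack .int M' (stackPtr F b) F.link = some l := by
  have := hF.link
  rw [loadstack_stackPtr hF (by omega) (by omega)]; exact h.link

theorem FrameMatch.loadstack_ra {M M' : Mem} {F : Fn} (hF : WTFn F) {b : Block} {Φ : FrameEnv}
    {l r : Val} (h : FrameMatch M M' F b Φ l r) :
    loadstack .int M' (stackPtr F b) F.retaddr = some r := by
  have := hF.retaddr
  rw [loadstack_stackPtr hF (by omega) (by omega)]; exact h.ra

theorem StackMatch.loadstack_parent {Q : Program Fn} (hQ : WTProgram Q) {M M' : Mem} {n : Block}
    {stk : List AltFrame} {stk' : List Frame} (h : StackMatch Q M M' n stk stk') {τ : Typ}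
    {δ : ℤ} {v : Val} (hg : getParentFrame stk τ δ = some v) :
    loadstack τ M' (parentSp stk') δ = some v := by
  obtain ⟨fr, stk₀, rfl, hv, rfl⟩ := getParentFrame_eq_some.1 hg
  cases h with
  | cons hF _ _ hm _ => exact hm.loadstack_slot (hF.wtFn hQ) hv

/-- The allocation of an activation record in the two semantics. -/
theorem exists_frameMatch_alloc {M M' : Mem} (h : M.Agree M') {F : Fn} (hF : WTFn F) {l r : Val}
    (hl : l.HasType .int) (hr : r.HasType .int) :
    ∃ M₂ M₃, storestack .int (M'.alloc F.stackLow F.stackHigh).2 (stackPtr F M.next) F.link l =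
        some M₂ ∧
      storestack .int M₂ (stackPtr F M.next) F.retaddr r = some M₃ ∧
      (M.alloc 0 F.stackHigh).2.Agree M₃ ∧
      (∀ b, b ≠ M.next → M₃.blocks b = M'.blocks b) ∧
      FrameMatch (M.alloc 0 F.stackHigh).2 M₃ F M.next undefFrame l r := by
  have hhi := hF.high
  have hlo := hF.low
  have hl' := hF.link
  have hr' := hF.retaddr
  have hd := hF.disjoint
  have hn := h.1
  have hag := h.alloc F.stackHigh hlo.2
  have hsz : ((Typ.int.chunk.size : ℕ) : ℤ) = 4 := rfl
  set M₀ := (M.alloc 0 F.stackHigh).2 with hM₀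
  set M₁ := (M'.alloc F.stackLow F.stackHigh).2 with hM₁
  have hB₀ : M₀.blocks M.next = _ := Mem.blocks_alloc
  have hB₁ : M₁.blocks M.next = ⟨F.stackLow, F.stackHigh, fun _ => .undef⟩ := by
    rw [hM₁, hn, Mem.blocks_alloc]
  obtain ⟨M₂, hs₂⟩ : ∃ M₂, M₁.store Typ.int.chunk M.next (F.stackLow + F.link) l = some M₂ := by
    refine ⟨_, Mem.store_eq_some.2 ⟨?_, rfl⟩⟩
    rw [Mem.InBounds, hB₁, hsz]
    exact ⟨by simp only; omega, by simp only; omega⟩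
  have hB₂ := Mem.blocks_store hs₂
  obtain ⟨M₃, hs₃⟩ : ∃ M₃, M₂.store Typ.int.chunk M.next (F.stackLow + F.retaddr) r =
      some M₃ := by
    refine ⟨_, Mem.store_eq_some.2 ⟨?_, rfl⟩⟩
    rw [Mem.InBounds, hB₂, hB₁, hsz]
    exact ⟨by simp only; omega, by simp only; omega⟩
  have hB₃ := Mem.blocks_store hs₃
  refine ⟨M₂, M₃, ?_, ?_, ?_, fun b hb => ?_, ?_⟩
  · rwa [storestack_stackPtr hF (by omega) (by omega)]
  · rwa [storestack_stackPtr hF (by omega) (by omega)]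
  -- Both reserved places end at or below offset 0, where the block of the alternate semantics
  -- begins.
  · refine (hag.store_right hs₂ ?_).store_right hs₃ ?_ <;> rw [hB₀, hsz] <;> simp only <;> omega
  · rw [Mem.blocks_store_of_ne hs₃ hb, Mem.blocks_store_of_ne hs₂ hb,
      Mem.blocks_alloc_of_ne (hn ▸ hb)]
  · refine ⟨by rw [hB₀], by rw [hB₃, hB₂, hB₁], by rw [hB₃, hB₂, hB₁], fun τ δ hv => ?_, ?_, ?_⟩
    · obtain ⟨h₀, h₁, h₂, h₃⟩ := hv
      have hτ := Typ.size_chunk τ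
      -- A valid slot avoids both writes, so it still has the initial contents of the fresh block,
      -- as in `undefFrame`.
      rw [Mem.load_store_disjoint hs₃ (by omega), Mem.load_store_disjoint hs₂ (by omega), hM₁, hn,
        Mem.load_alloc (by omega) (by omega)]
      rfl
    · rw [Mem.load_store_disjoint hs₃ (by rw [hsz]; simp only [Chunk.size]; omega)]
      exact (Mem.load_store_same hs₂).trans (by rw [cast_chunk hl])
    · exact (Mem.load_store_same hs₃).trans (by rw [cast_chunk hr])

/-- Matching states of the alternate and the standard semantics. -/
inductive StateMatch (Q : Program Fn) : AltState → State → Prop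
  | regular {stk stk' F b c R Φ M M'} :
      IsFn Q F → c <:+ F.code → b < M.next →
      FrameMatch M M' F b Φ (parentSp stk') (parentRa stk') →
      StackMatch Q M M' b stk stk' → M.Agree M' →
      StateMatch Q (.regular stk F (.ptr b (BitVec.ofInt 32 F.stackLow)) c R Φ M)
        (.regular stk' F (.ptr b (BitVec.ofInt 32 F.stackLow)) c R M')
  | call {stk stk' fd R M M'} :
      (∃ id, (id, fd) ∈ Q.functs) → StackMatch Q M M' M.next stk stk' → M.Agree M' →
      StateMatch Q (.call stk fd R M) (.call stk' fd R M')
  | ret {stk stk' R M M'} :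
      StackMatch Q M M' M.next stk stk' → M.Agree M' →
      StateMatch Q (.ret stk R M) (.ret stk' R M')

theorem mapM_mono {α β : Type} {f g : α → Option β} (h : ∀ a b, f a = some b → g a = some b)
    {l : List α} {l' : List β} (hl : l.mapM f = some l') : l.mapM g = some l' := by
  induction l generalizing l' with
  | nil => simpa using hl
  | cons a l ih =>
    simp only [List.mapM_cons, Option.bind_eq_bind, Option.bind_eq_some_iff,
      Option.pure_def] at hl ⊢
    obtain ⟨b, hb, l'', hl'', hl⟩ := hl
    cases hl
    exact ⟨b, h a b hb, l'', ih hl'', rfl⟩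

/-- Program accesses are transferred by `Mem.Agree` and frame accesses by `FrameMatch`. The links
stored at entry are the values checked at return, because every frame of the stack keeps them
intact. -/
theorem step_of_altStep {retaddr : RetAddr} {Q : Program Fn} (hQ : WTProgram Q)
    (hra : HasReturnAddresses retaddr Q) {S₁ S₁' : AltState} {S₂ : State} {t : Trace}
    (hwt : WTState S₁) (hm : StateMatch Q S₁ S₂) (hs : AltStep (globalenv Q) S₁ t S₁') :
    ∃ S₂', Step retaddr (globalenv Q) S₂ t S₂' ∧ StateMatch Q S₁' S₂' := by
  cases hm with
  | @regular stk stk' F b c R Φ M M' hF hc hb hfr hstk hag =>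
    have hwF := hF.wtFn hQ
    cases hs with
    | setstack h =>
      obtain ⟨hv, rfl⟩ := setFrame_eq_some.1 h
      rename_i r τ δ c
      obtain ⟨-, -, hwc, hwR, -⟩ := hwt
      have hτ : r.typ = τ := hwc _ List.mem_cons_self
      have hsz := Typ.size_chunk τ
      have hpos := Typ.size_pos τ
      -- The slot lies in `[low, 0)`, which is inside the bounds of the record in the standard
      -- memory.
      obtain ⟨M₁', hs'⟩ : ∃ M₁', M'.store τ.chunk b (F.stackLow + δ) (R r) = some M₁' := by
        refine ⟨_, Mem.store_eq_some.2 ⟨?_, rfl⟩⟩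
        have h₁ := hv.1
        have h₂ := hv.2.1
        have h₃ := hwF.high
        rw [Mem.InBounds, hfr.lo', hfr.hi']
        constructor <;> omega
      refine ⟨_, .setstack ?_, .regular hF ((List.suffix_cons _ _).trans hc) hb
        (hfr.setFrame (hτ ▸ hwR r) hv hs')
        (hstk.congr (fun _ _ => rfl) fun b' hb' => Mem.blocks_store_of_ne hs' hb'.ne)
        (hag.store_right hs' ?_)⟩
      · have := hv.2.1
        exact (storestack_stackPtr hwF hv.1 (by omega)).trans hs'
      -- The alternate memory does not perform this store; agreement persists because the slot lies
      -- below the bounds of its block.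
      · have h₁ := hfr.lo
        have := hv.2.1
        omega
    | getstack h =>
      obtain ⟨hv, rfl⟩ := getFrame_eq_some.1 h
      exact ⟨_, .getstack (hfr.loadstack_slot hwF hv),
        .regular hF ((List.suffix_cons _ _).trans hc) hb hfr hstk hag⟩
    | getparent h =>
      exact ⟨_, .getparent (hfr.loadstack_link hwF) (hstk.loadstack_parent hQ h),
        .regular hF ((List.suffix_cons _ _).trans hc) hb hfr hstk hag⟩
    | op h =>
      exact ⟨_, .op h, .regular hF ((List.suffix_cons _ _).trans hc) hb hfr hstk hag⟩
    | load h₁ h₂ =>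
      exact ⟨_, .load h₁ (hag.extends _ _ _ _ h₂),
        .regular hF ((List.suffix_cons _ _).trans hc) hb hfr hstk hag⟩
    | store h₁ h₂ =>
      obtain ⟨M₁', hs', hag'⟩ := hag.store h₂
      exact ⟨_, .store h₁ hs', .regular hF ((List.suffix_cons _ _).trans hc)
        (by rwa [Mem.next_store h₂]) (hfr.store hwF h₂ hs')
        (hstk.map fun _ _ _ _ _ _ hF' hm => hm.store (hF'.wtFn hQ) h₂ hs') hag'⟩
    | call h₁ h₂ =>
      obtain ⟨id, hid⟩ := id hF
      -- The state invariant records that the current code is a suffix of the body of a program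
      -- function precisely for this use of the oracle.
      obtain ⟨b', δ', hr⟩ := hra id F hid _ _ _ hc
      exact ⟨_, .call h₁ h₂ hr, .call (mem_functs_of_findFunction h₁)
        (.cons hF ((List.suffix_cons _ _).trans hc) hb hfr hstk) hag⟩
    | tailcall h₁ h₂ =>
      exact ⟨_, .tailcall h₁ h₂ (hfr.loadstack_link hwF) (hfr.loadstack_ra hwF),
        .call (mem_functs_of_findFunction h₁)
          -- The callers' blocks are strictly below `b`, so freeing `b` does not affect them; the
          -- bound is then raised to the next free block.
          ((hstk.congr (fun b' hb' => Mem.blocks_free_of_ne hb'.ne)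
            fun b' hb' => Mem.blocks_free_of_ne hb'.ne).mono hb.le) (hag.free b)⟩
    | cond_true h₁ h₂ =>
      exact ⟨_, .cond_true h₁ h₂, .regular hF (findLabel_suffix h₂) hb hfr hstk hag⟩
    | cond_false h =>
      exact ⟨_, .cond_false h, .regular hF ((List.suffix_cons _ _).trans hc) hb hfr hstk hag⟩
    | goto h =>
      exact ⟨_, .goto h, .regular hF (findLabel_suffix h) hb hfr hstk hag⟩
    | label =>
      exact ⟨_, .label, .regular hF ((List.suffix_cons _ _).trans hc) hb hfr hstk hag⟩
    | ret =>
      exact ⟨_, .ret (hfr.loadstack_link hwF) (hfr.loadstack_ra hwF),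
        .ret ((hstk.congr (fun b' hb' => Mem.blocks_free_of_ne hb'.ne)
          fun b' hb' => Mem.blocks_free_of_ne hb'.ne).mono hb.le) (hag.free b)⟩
  | @call stk stk' fd R M M' hfd hstk hag =>
    cases hs with
    | @internal _ F _ _ b M₁ h =>
      obtain ⟨M₂, M₃, h₂, h₃, hag', hne, hfr⟩ := exists_frameMatch_alloc hag
        (IsFn.wtFn hfd hQ) hstk.hasType_parentSp hstk.hasType_parentRa
      obtain ⟨rfl, rfl⟩ : M.next = b ∧ (M.alloc 0 F.stackHigh).2 = M₁ :=
        ⟨congrArg Prod.fst h, congrArg Prod.snd h⟩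
      exact ⟨_, .internal (by rw [hag.1]; rfl) h₂ h₃, .regular hfd List.suffix_rfl
        (Int.lt_succ _) hfr
        (hstk.congr (fun b hb => Mem.blocks_alloc_of_ne hb.ne) fun b hb => hne b hb.ne) hag'⟩
    | external h₁ h₂ =>
      refine ⟨_, .external (mapM_mono (fun ℓ v h => ?_) h₁) h₂, .ret hstk hag⟩
      unfold altExtArg at h
      split at h
      · exact h
      · exact hstk.loadstack_parent hQ h
      · simp at h
  | ret hstk hag =>
    cases hs with
    | resume =>
      cases hstk with
      | cons hF hc hb hfr hstk => exact ⟨_, .resume, .regular hF hc hb hfr hstk hag⟩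

theorem lockStepSimulationOn_stateMatch {retaddr : RetAddr} {Q : Program Fn} (hQ : WTProgram Q)
    (hra : HasReturnAddresses retaddr Q) :
    LockStepSimulationOn (altSem Q) (sem retaddr Q) WTState (StateMatch Q) where
  initial_exists := by
    rintro S₁ ⟨h₁, h₂, h₃⟩
    exact ⟨_, .intro h₁ h₂ h₃⟩
  initial := by
    rintro S₁ S₂ ⟨h₁, h₂, h₃⟩ ⟨h₁', h₂', h₃'⟩
    obtain rfl := Option.some.inj (h₁.symm.trans h₁')
    obtain rfl := Option.some.inj (h₂.symm.trans h₂')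
    exact .call (mem_functs_of_funct h₂) .nil (.refl _)
  final := by
    rintro S₁ S₂ n hR ⟨h⟩
    cases hR with
    | ret hstk _ => cases hstk; exact .intro h
  lockstep _ _ _ _ hwt hm hs := step_of_altStep hQ hra hwt hm hs

theorem StateMatch.regs_eq_and_extends {Q : Program Fn} {S₁ : AltState} {S₂ : State}
    (h : StateMatch Q S₁ S₂) : S₁.regs = S₂.regs ∧ S₁.mem.Extends S₂.mem := by
  cases h with
  | regular _ _ _ _ _ h | call _ _ h | ret _ h => exact ⟨rfl, h.extends⟩

end Mach

/-! ### Transformation of programs -/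

section Transf

variable {F₁ F₂ : Type} {tr : F₁ → Option F₂}

theorem forall₂_of_mapM_eq_some {α β : Type} {f : α → Option β} {l : List α} {l' : List β}
    (h : l.mapM f = some l') : List.Forall₂ (fun a b => f a = some b) l l' := by
  induction l generalizing l' with
  | nil => cases h; exact .nil
  | cons a l ih =>
    simp only [List.mapM_cons, Option.bind_eq_bind, Option.bind_eq_some_iff,
      Option.pure_def] at h
    obtain ⟨b, hb, l'', hl'', h⟩ := h
    cases h
    exact .cons hb (ih hl'')

theorem mapM_eq_some_map {α β : Type} {f : α → Option β} {g : α → β} {l : List α}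
    (h : ∀ a ∈ l, f a = some (g a)) : l.mapM f = some (l.map g) := by
  induction l with
  | nil => rfl
  | cons a l ih =>
    obtain ⟨ha, hl⟩ := List.forall_mem_cons.1 h
    simp [ha, ih hl]

/-- Corresponding definitions of a program and of its transformation. -/
def DefMatch (tr : F₁ → Option F₂) (d : Ident × FunDef F₁) (d' : Ident × FunDef F₂) : Prop :=
  d.1 = d'.1 ∧ transfFunDef tr d.2 = some d'.2

theorem transfProgram_eq_some {P : Program F₁} {Q : Program F₂}
    (h : transfProgram tr P = some Q) :
    P.vars = Q.vars ∧ P.main = Q.main ∧ List.Forall₂ (DefMatch tr) P.functs Q.functs := by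
  obtain ⟨fs, hfs, rfl⟩ := Option.map_eq_some_iff.1 h
  refine ⟨rfl, rfl, (forall₂_of_mapM_eq_some hfs).imp fun d d' hd => ?_⟩
  obtain ⟨fd, hfd, rfl⟩ := Option.map_eq_some_iff.1 hd
  exact ⟨rfl, hfd⟩

theorem findIdx?_forall₂ {l : List (Ident × FunDef F₁)} {l' : List (Ident × FunDef F₂)}
    (h : List.Forall₂ (DefMatch tr) l l') (id : Ident) :
    l.findIdx? (fun d => d.1 == id) = l'.findIdx? (fun d => d.1 == id) := by
  induction h with
  | nil => rfl
  | cons h _ ih => rw [List.findIdx?_cons, List.findIdx?_cons, h.1, ih]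

/-- Blocks are determined by positions in the lists of definitions, and the transformation keeps
names and positions. -/
theorem symbol_transfProgram {P : Program F₁} {Q : Program F₂}
    (h : transfProgram tr P = some Q) (id : Ident) :
    (globalenv P).symbol id = (globalenv Q).symbol id := by
  obtain ⟨hv, -, hf⟩ := transfProgram_eq_some h
  simp only [globalenv, findIdx?_forall₂ hf, hv]

theorem getElem?_forall₂ {α β : Type} {r : α → β → Prop} {l : List α} {l' : List β}
    (h : List.Forall₂ r l l') {i : ℕ} {a : α} (ha : l[i]? = some a) :
    ∃ b, l'[i]? = some b ∧ r a b := by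
  induction h generalizing i with
  | nil => simp at ha
  | cons h _ ih =>
    cases i with
    | zero => cases ha; exact ⟨_, rfl, h⟩
    | succ i => exact ih (by simpa using ha)

theorem funct_transfProgram {P : Program F₁} {Q : Program F₂} (h : transfProgram tr P = some Q)
    {b : Block} {fd : FunDef F₁} (hfd : (globalenv P).funct b = some fd) :
    ∃ fd', (globalenv Q).funct b = some fd' ∧ transfFunDef tr fd = some fd' := by
  obtain ⟨-, -, hf⟩ := transfProgram_eq_some h
  simp only [globalenv] at hfd ⊢
  split_ifs at hfd ⊢
  obtain ⟨d, hd, rfl⟩ := Option.map_eq_some_iff.1 hfd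
  obtain ⟨d', hd', hdd⟩ := getElem?_forall₂ hf hd
  exact ⟨d'.2, by rw [hd', Option.map_some], hdd.2⟩

/-- The two register maps are compared only at the register that is read: at a tail call, they
differ on restored callee-save registers. -/
theorem findFunction_transfProgram {P : Program F₁} {Q : Program F₂}
    (h : transfProgram tr P = some Q) {rs rs' : MReg → Val} {f : FunRef}
    (hrs : ∀ r, f = .reg r → rs' r = rs r) {fd : FunDef F₁}
    (hfd : findFunction (globalenv P) rs f = some fd) :
    ∃ fd', findFunction (globalenv Q) rs' f = some fd' ∧ transfFunDef tr fd = some fd' := by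
  cases f with
  | reg r =>
    simp only [findFunction, hrs r rfl] at hfd ⊢
    split at hfd
    · split_ifs at hfd ⊢ with hδ
      exact funct_transfProgram h hfd
    · simp at hfd
  | sym id =>
    obtain ⟨b, hb, hfd⟩ := Option.bind_eq_some_iff.1 hfd
    obtain ⟨fd', h', ht⟩ := funct_transfProgram h hfd
    exact ⟨fd', Option.bind_eq_some_iff.2 ⟨b, by rwa [← symbol_transfProgram h], h'⟩, ht⟩

theorem initmem_transfProgram {P : Program F₁} {Q : Program F₂}
    (h : transfProgram tr P = some Q) : initmem P = initmem Q := by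
  simp only [initmem, (transfProgram_eq_some h).1]

end Transf

/-! ### Registers and calling conventions -/

theorem typ_of_mem_intCalleeSave {r : MReg} (h : r ∈ intCalleeSave) : r.typ = .int := by
  revert r; decide

theorem typ_of_mem_floatCalleeSave {r : MReg} (h : r ∈ floatCalleeSave) : r.typ = .float := by
  revert r; decide

/-- The result of an external call can thus be written without disturbing the callee-save registers.
-/
theorem not_calleeSave_locResult (s : Sig) : ¬ (locResult s).CalleeSave := by
  unfold locResult
  split <;> decide

/-- Monotonicity of the offset is proved together with the bound: a stack argument ends where the
next one may start, and that is at most the final size. -/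
theorem locArgumentsFrom_spec (τs : List Typ) (ir fr : List MReg) (ofs : ℕ) :
    ofs ≤ (locArgumentsFrom τs ir fr ofs).2 ∧
      ∀ s, Loc.slot s ∈ (locArgumentsFrom τs ir fr ofs).1 →
        ∃ τ δ, s = .outgoing τ δ ∧ δ + τ.words ≤ (locArgumentsFrom τs ir fr ofs).2 := by
  fun_induction locArgumentsFrom τs ir fr ofs with
  | case1 => simp
  | case2 _ _ _ _ _ _ ih | case4 _ _ _ _ _ _ ih => simpa using ih
  | case3 _ _ _ _ ih | case5 _ _ _ _ ih =>
    refine ⟨(Nat.le_add_right _ _).trans ih.1, fun s hs => ?_⟩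
    rcases List.mem_cons.1 hs with h | h
    · cases h
      refine ⟨_, _, rfl, ?_⟩
      simp only [Typ.words]
      exact ih.1
    · exact ih.2 s h

theorem locArguments_slot {sig : Sig} {s : Slot} (h : Loc.slot s ∈ locArguments sig) :
    ∃ τ δ, s = .outgoing τ δ ∧ δ + τ.words ≤ sizeArguments sig :=
  (locArgumentsFrom_spec _ _ _ _).2 s h

/-- Argument locations never contain incoming slots, so an incoming parameter can only be the image
of the corresponding outgoing argument. -/
theorem mem_locArguments_of_incoming {sig : Sig} {τ : Typ} {δ : ℕ}
    (h : Loc.slot (.incoming τ δ) ∈ locParameters sig) :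
    Loc.slot (.outgoing τ δ) ∈ locArguments sig := by
  obtain ⟨ℓ, hℓ, he⟩ := List.mem_map.1 h
  split at he
  · cases he; exact hℓ
  · subst he
    obtain ⟨_, _, h, -⟩ := locArguments_slot hℓ
    cases h

/-! ### Updates of location maps, and labels in Linear. -/

namespace Linear

theorem LocMap.set_reg (L : LocMap) (r r' : MReg) (v : Val) :
    L.set (.reg r) v (.reg r') = if r = r' then v else L (.reg r') := by
  by_cases h : r = r' <;> simp [LocMap.set, Loc.Overlap, h]

@[simp] theorem LocMap.set_reg_slot (L : LocMap) (r : MReg) (s : Slot) (v : Val) :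
    L.set (.reg r) v (.slot s) = L (.slot s) := by
  simp [LocMap.set, Loc.Overlap]

@[simp] theorem LocMap.set_slot_reg (L : LocMap) (r : MReg) (s : Slot) (v : Val) :
    L.set (.slot s) v (.reg r) = L (.reg r) := by
  simp [LocMap.set, Loc.Overlap]

theorem LocMap.set_slot (L : LocMap) (s s' : Slot) (v : Val) :
    L.set (.slot s) v (.slot s') =
      if s = s' then v else if s.Overlap s' then .undef else L (.slot s') := by
  simp [LocMap.set, Loc.Overlap]

theorem findLabel_suffix {l : Label} {c c' : Code} (h : findLabel l c = some c') : c' <:+ c := by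
  induction c with
  | nil => simp [findLabel] at h
  | cons i c ih =>
    unfold findLabel at h
    split at h
    · simp at h
    · rename_i heq
      cases heq
      split at h
      · cases h; exact List.suffix_rfl
      · exact (ih h).trans (List.suffix_cons _ _)
    · rename_i heq
      cases heq
      exact (ih h).trans (List.suffix_cons _ _)

end Linear

namespace Stacking

/-- The result of the translation of a function whose frame is not too large. -/
def machFn (F : Linear.Fn) : Mach.Fn where
  sig := F.sig
  stackHigh := F.stacksize
  stackLow := -(frameSize F : ℤ)
  retaddr := ofsRetaddr
  link := ofsLink
  code := saveCode F ++ F.code.flatMap (transfInstr F)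

theorem transfFn_eq_some {F : Linear.Fn} {F' : Mach.Fn} :
    transfFn F = some F' ↔ frameSize F ≤ 2 ^ 31 ∧ machFn F = F' := by
  unfold transfFn
  split_ifs with h
  · exact ⟨fun e => ⟨h, Option.some.inj e⟩, fun e => congrArg some e.2⟩
  · exact ⟨fun e => by simp at e, fun e => absurd e.1 h⟩

/-! ### Layout of activation records -/

theorem le_maxOver {F : Linear.Fn} (f : Linear.Instr → ℕ) {i : Linear.Instr} (h : i ∈ F.code) :
    f i ≤ maxOver F f := by
  unfold maxOver
  generalize F.code = c at h
  induction c with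
  | nil => simp at h
  | cons j c ih =>
    simp only [List.map_cons, List.foldr_cons]
    rcases List.mem_cons.1 h with rfl | h
    · exact le_max_left _ _
    · exact (ih h).trans (le_max_right _ _)

/-- The slot has a place in the activation record of `F`. -/
def InFrame (F : Linear.Fn) : Slot → Prop
  | .localSlot τ δ => δ + τ.words ≤ localWords F τ
  | .outgoing τ δ => δ + τ.words ≤ outgoingWords F
  | .incoming _ _ => False

theorem inFrame_of_need {F : Linear.Fn} {s : Slot} {i : Linear.Instr} (hi : i ∈ F.code)
    (h : ∃ r, i = .getstack s r ∨ i = .setstack r s) (hs : ∀ τ δ, s ≠ .incoming τ δ) :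
    InFrame F s := by
  -- The two functions repeat those in the definitions of `localWords` and `outgoingWords`, so that
  -- the bounds hold by unfolding.
  have h₁ := fun τ => le_maxOver (fun
    | .getstack s _ | .setstack _ s => localNeed τ s
    | _ => 0) hi
  have h₂ := le_maxOver (fun
    | .getstack s _ | .setstack _ s => outgoingNeed s
    | .call sig _ => sizeArguments sig
    | _ => 0) hi
  obtain ⟨r, rfl | rfl⟩ := h <;> cases s with
  | localSlot τ δ => exact (if_pos rfl).ge.trans (h₁ τ)
  | incoming τ δ => exact absurd rfl (hs τ δ)
  | outgoing τ δ => exact h₂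

theorem sizeArguments_le {F : Linear.Fn} {sig : Sig} {f : FunRef}
    (h : Linear.Instr.call sig f ∈ F.code) : sizeArguments sig ≤ outgoingWords F :=
  le_maxOver (fun
    | .getstack s _ | .setstack _ s => outgoingNeed s
    | .call sig _ => sizeArguments sig
    | _ => 0) h

/-- The only facts about padding that the layout needs: rounding up never makes an area run into the
next one. -/
theorem ofsFloatLocal_bounds (F : Linear.Fn) :
    ofsIntSaved F + 4 * (savedInt F).length ≤ ofsFloatLocal F ∧
      ofsFloatLocal F + 4 * localWords F .float ≤ ofsFloatSaved F := by
  unfold ofsFloatSaved ofsFloatLocal align8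
  omega

/-- The byte ranges of two typed positions meet. -/
def BytesMeet (τ : Typ) (δ : ℤ) (τ' : Typ) (δ' : ℤ) : Prop :=
  δ < δ' + τ'.size ∧ δ' < δ + τ.size

/-- Inside one area, word ranges are scaled by 4; distinct areas are disjoint. Integer and float
locals lie in different areas, which matches the condition on types in `Slot.Overlap`. -/
theorem overlap_iff_bytesMeet {F : Linear.Fn} {s s' : Slot} (h : InFrame F s)
    (h' : InFrame F s') :
    s.Overlap s' ↔ BytesMeet s.typ (slotOfs F s) s'.typ (slotOfs F s') := by
  obtain ⟨h₁, h₂⟩ := ofsFloatLocal_bounds F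
  have h₃ : ofsIntLocal F = 8 + 4 * outgoingWords F := rfl
  have h₄ : ofsIntSaved F = ofsIntLocal F + 4 * localWords F .int := rfl
  have h₅ : ofsOutgoing = 8 := rfl
  unfold BytesMeet
  rcases s with ⟨_ | _, δ⟩ | ⟨τ, δ⟩ | ⟨_ | _, δ⟩ <;>
    rcases s' with ⟨_ | _, δ'⟩ | ⟨τ', δ'⟩ | ⟨_ | _, δ'⟩ <;>
    simp only [InFrame, Typ.words] at h h' <;>
    simp [Slot.Overlap, wordsMeet, Slot.typ, slotOfs, Typ.size, Typ.words] <;> omega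

/-- Overlapping but different slots must not land on the same typed position, for there the location
map gives `undef` and the frame would give the written value. -/
theorem eq_of_slotOfs_eq {F : Linear.Fn} {s s' : Slot} (h : InFrame F s)
    (h' : InFrame F s') (ht : s.typ = s'.typ) (ho : slotOfs F s = slotOfs F s') : s = s' := by
  obtain ⟨h₁, h₂⟩ := ofsFloatLocal_bounds F
  have h₃ : ofsIntLocal F = 8 + 4 * outgoingWords F := rfl
  have h₄ : ofsIntSaved F = ofsIntLocal F + 4 * localWords F .int := rfl
  have h₅ : ofsOutgoing = 8 := rfl
  rcases s with ⟨_ | _, δ⟩ | ⟨τ, δ⟩ | ⟨_ | _, δ⟩ <;>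
    rcases s' with ⟨_ | _, δ'⟩ | ⟨τ', δ'⟩ | ⟨_ | _, δ'⟩ <;>
    simp only [InFrame, Typ.words, Slot.typ, slotOfs, reduceCtorEq] at h h' ht ho <;>
    first | omega | (congr 1; omega)

theorem mem_saved {F : Linear.Fn} {r : MReg} :
    r ∈ saved F ↔ r.CalleeSave ∧ r ∈ usedRegs F := by
  simp only [saved, savedInt, savedFloat, List.mem_append, List.mem_filter, MReg.CalleeSave,
    decide_eq_true_eq]
  tauto

theorem nodup_saved (F : Linear.Fn) : (saved F).Nodup := by
  refine List.Nodup.append (List.Nodup.filter _ (by decide)) (List.Nodup.filter _ (by decide)) ?_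
  intro r h₁ h₂
  have := typ_of_mem_intCalleeSave (List.mem_of_mem_filter h₁)
  rw [typ_of_mem_floatCalleeSave (List.mem_of_mem_filter h₂)] at this
  cases this

/-- The place of a saved register. -/
theorem regOfs_bounds {F : Linear.Fn} {r : MReg} (h : r ∈ saved F) :
    (r.typ = .int ∧ r ∈ savedInt F ∧ regOfs F r = ofsIntSaved F + 4 * (savedInt F).idxOf r ∧
      (savedInt F).idxOf r < (savedInt F).length) ∨
    (r.typ = .float ∧ r ∈ savedFloat F ∧
      regOfs F r = ofsFloatSaved F + 8 * (savedFloat F).idxOf r ∧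
      (savedFloat F).idxOf r < (savedFloat F).length) := by
  rcases List.mem_append.1 h with h | h
  · have ht := typ_of_mem_intCalleeSave (List.mem_of_mem_filter h)
    exact .inl ⟨ht, h, if_pos h, List.idxOf_lt_length_of_mem h⟩
  · have ht := typ_of_mem_floatCalleeSave (List.mem_of_mem_filter h)
    refine .inr ⟨ht, h, if_neg fun h' => ?_, List.idxOf_lt_length_of_mem h⟩
    rw [typ_of_mem_intCalleeSave (List.mem_of_mem_filter h')] at ht
    cases ht

theorem not_bytesMeet_slot_reg {F : Linear.Fn} {s : Slot} {r : MReg} (h : InFrame F s)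
    (h' : r ∈ saved F) : ¬ BytesMeet s.typ (slotOfs F s) r.typ (regOfs F r) := by
  obtain ⟨h₁, h₂⟩ := ofsFloatLocal_bounds F
  have h₃ : ofsIntLocal F = 8 + 4 * outgoingWords F := rfl
  have h₄ : ofsIntSaved F = ofsIntLocal F + 4 * localWords F .int := rfl
  have h₅ : ofsOutgoing = 8 := rfl
  unfold BytesMeet
  rcases regOfs_bounds h' with ⟨ht, -, ho, hi⟩ | ⟨ht, -, ho, hi⟩ <;> rw [ht, ho] <;>
    rcases s with ⟨_ | _, δ⟩ | ⟨τ, δ⟩ | ⟨_ | _, δ⟩ <;>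
    simp only [InFrame, Typ.words] at h <;>
    simp only [Slot.typ, slotOfs, Typ.size] <;> omega

theorem not_bytesMeet_reg_reg {F : Linear.Fn} {r r' : MReg} (h : r ∈ saved F)
    (h' : r' ∈ saved F) (hne : r ≠ r') :
    ¬ BytesMeet r.typ (regOfs F r) r'.typ (regOfs F r') := by
  obtain ⟨h₁, h₂⟩ := ofsFloatLocal_bounds F
  unfold BytesMeet
  rcases regOfs_bounds h with ⟨ht, hm, ho, hi⟩ | ⟨ht, hm, ho, hi⟩ <;>
    rcases regOfs_bounds h' with ⟨ht', -, ho', hi'⟩ | ⟨ht', -, ho', hi'⟩ <;>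
    rw [ht, ho, ht', ho'] <;> simp only [Typ.size]
  · have := mt (List.idxOf_inj hm).1 hne
    omega
  · omega
  · omega
  · have := mt (List.idxOf_inj hm).1 hne
    omega

theorem slotValid_slot {F : Linear.Fn} {s : Slot} (h : InFrame F s) :
    Mach.SlotValid (machFn F) s.typ (slotOfs F s) := by
  obtain ⟨h₁, h₂⟩ := ofsFloatLocal_bounds F
  have h₃ : ofsIntLocal F = 8 + 4 * outgoingWords F := rfl
  have h₄ : ofsIntSaved F = ofsIntLocal F + 4 * localWords F .int := rfl
  have h₅ : ofsOutgoing = 8 := rfl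
  have h₆ : frameSize F = ofsFloatSaved F + 8 * (savedFloat F).length := rfl
  rcases s with ⟨_ | _, δ⟩ | ⟨τ, δ⟩ | ⟨_ | _, δ⟩ <;>
    simp only [InFrame, Typ.words] at h <;>
    simp only [Mach.SlotValid, machFn, ofsLink, ofsRetaddr, Slot.typ, slotOfs, Typ.size] <;>
    omega

theorem slotValid_reg {F : Linear.Fn} {r : MReg} (h : r ∈ saved F) :
    Mach.SlotValid (machFn F) r.typ (regOfs F r) := by
  obtain ⟨h₁, h₂⟩ := ofsFloatLocal_bounds F
  have h₃ : ofsIntLocal F = 8 + 4 * outgoingWords F := rfl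
  have h₄ : ofsIntSaved F = ofsIntLocal F + 4 * localWords F .int := rfl
  have h₆ : frameSize F = ofsFloatSaved F + 8 * (savedFloat F).length := rfl
  unfold Mach.SlotValid
  simp only [machFn, ofsLink, ofsRetaddr]
  rcases regOfs_bounds h with ⟨ht, -, ho, hi⟩ | ⟨ht, -, ho, hi⟩ <;> rw [ht, ho] <;>
    simp only [Typ.size] <;> omega

/-! ### Typing of the compiled program -/

theorem wtOp_transfOp {F : Linear.Fn} {o : Op} {args : List MReg} {res : MReg}
    (h : WTOp o args res) : WTOp (transfOp F o) args res := by
  cases o <;> simpa [transfOp, WTOp, Op.typ] using h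

theorem typ_transfMode (F : Linear.Fn) (m : Mode) : (transfMode F m).typ = m.typ := by
  cases m <;> rfl

theorem wtCode_restoreCode (F : Linear.Fn) : Mach.WTCode (restoreCode F) := by
  intro i hi
  obtain ⟨r, -, rfl⟩ := List.mem_map.1 hi
  exact rfl

theorem wtCode_saveCode (F : Linear.Fn) : Mach.WTCode (saveCode F) := by
  intro i hi
  obtain ⟨r, -, rfl⟩ := List.mem_map.1 hi
  exact rfl

theorem wtCode_append {c c' : Mach.Code} (h : Mach.WTCode c) (h' : Mach.WTCode c') :
    Mach.WTCode (c ++ c') := List.forall_mem_append.2 ⟨h, h'⟩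

theorem wtCode_singleton {i : Mach.Instr} (h : Mach.WTInstr i) : Mach.WTCode [i] := by
  simpa [Mach.WTCode] using h

theorem wtCode_transfInstr {F : Linear.Fn} {i : Linear.Instr} (h : Linear.WTInstr F i) :
    Mach.WTCode (transfInstr F i) := by
  cases i with
  | getstack s r =>
    obtain ⟨h, -⟩ := h
    cases s <;> exact wtCode_singleton h.symm
  | setstack r s =>
    obtain ⟨h, h'⟩ := h
    cases s with
    | incoming => exact h'.elim
    | localSlot | outgoing => exact wtCode_singleton h.symm
  | op o args res => exact wtCode_singleton (wtOp_transfOp h)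
  | load κ m args dst | store κ m args src =>
    exact wtCode_singleton ⟨(typ_transfMode F m).symm ▸ h.1, h.2⟩
  | call sig f | cond c args l | goto l | label l => exact wtCode_singleton h
  | tailcall sig f => exact wtCode_append (wtCode_restoreCode F) (wtCode_singleton h.1)
  | ret => exact wtCode_append (wtCode_restoreCode F) (wtCode_singleton trivial)

theorem wtFn_machFn {F : Linear.Fn} (h : Linear.WTFn F) (hF : frameSize F ≤ 2 ^ 31) :
    Mach.WTFn (machFn F) := by
  obtain ⟨h₁, h₂⟩ := ofsFloatLocal_bounds F
  have h₃ : ofsIntLocal F = 8 + 4 * outgoingWords F := rfl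
  have h₄ : ofsIntSaved F = ofsIntLocal F + 4 * localWords F .int := rfl
  have h₆ : frameSize F = ofsFloatSaved F + 8 * (savedFloat F).length := rfl
  constructor <;> simp only [machFn, ofsLink, ofsRetaddr]
  · refine wtCode_append (wtCode_saveCode F) fun i hi => ?_
    obtain ⟨j, hj, hi⟩ := List.mem_flatMap.1 hi
    exact wtCode_transfInstr (h j hj) i hi
  all_goals omega

theorem wtProgram_transf {P : Program Linear.Fn} {Q : Program Mach.Fn}
    (hP : Linear.WTProgram P) (h : transf P = some Q) : Mach.WTProgram Q := by
  intro id fd hfd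
  obtain ⟨-, -, hf⟩ := transfProgram_eq_some h
  obtain ⟨i, hi⟩ := List.getElem?_of_mem hfd
  -- The correspondence is read backwards, to find the source of a given target definition.
  obtain ⟨⟨id', fd₀⟩, hd, -, ht⟩ := getElem?_forall₂ (r := fun b a => DefMatch transfFn a b)
    hf.flip hi
  cases fd₀ with
  | internal F =>
    obtain ⟨F', hF', rfl⟩ := Option.map_eq_some_iff.1 ht
    obtain ⟨hle, rfl⟩ := transfFn_eq_some.1 hF'
    exact wtFn_machFn (hP id' F (List.mem_of_getElem? hd)) hle
  | external fe => cases ht; trivial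

end Stacking
namespace Stacking

open Linear (LocMap parentLocs exitfun entryfun)

/-! ### Operators and addressing modes under the translation -/

/-- The stack pointer is at offset `-frameSize F`, and the shift of the operand cancels it modulo
`2^32`. -/
theorem addOfs_stackPtr (F : Linear.Fn) (σ : Block) (δ : Int32b) :
    (Mach.stackPtr (machFn F) σ).addOfs (BitVec.ofNat 32 (frameSize F) + δ) =
      (Val.ptr σ 0).addOfs δ := by
  simp only [Mach.stackPtr, machFn, Val.addOfs]
  rw [BitVec.ofInt_neg, BitVec.ofInt_natCast, neg_add_cancel_left, zero_add]

theorem symbolAddr_transf {P : Program Linear.Fn} {Q : Program Mach.Fn} (h : transf P = some Q)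
    (id : Ident) (δ : Int32b) :
    symbolAddr (globalenv Q) id δ = symbolAddr (globalenv P) id δ := by
  rw [symbolAddr, symbolAddr, symbol_transfProgram h]

/-- Only `addrsymbol` consults the global environment, and only `addrstack` the stack pointer; every
other operator evaluates identically. -/
theorem evalOp_transfOp {P : Program Linear.Fn} {Q : Program Mach.Fn} (h : transf P = some Q)
    {F : Linear.Fn} {σ : Block} {o : Op} {vs : List Val} {v : Val}
    (hv : evalOp (globalenv P) (.ptr σ 0) o vs = some v) :
    evalOp (globalenv Q) (Mach.stackPtr (machFn F) σ) (transfOp F o) vs = some v := by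
  unfold evalOp at hv
  split at hv <;>
    first
    | exact hv
    | exact (symbolAddr_transf h _ _).trans hv
    | exact (addOfs_stackPtr F σ _).trans hv
    | cases hv

theorem evalMode_transfMode {P : Program Linear.Fn} {Q : Program Mach.Fn} (h : transf P = some Q)
    {F : Linear.Fn} {σ : Block} {m : Mode} {vs : List Val} {v : Val}
    (hv : evalMode (globalenv P) (.ptr σ 0) m vs = some v) :
    evalMode (globalenv Q) (Mach.stackPtr (machFn F) σ) (transfMode F m) vs = some v := by
  unfold evalMode at hv
  split at hv <;>
    first
    | exact hv
    | exact (symbolAddr_transf h _ _).trans hv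
    | exact (addOfs_stackPtr F σ _).trans hv
    | cases hv

/-! ### Labels -/

theorem findLabel_saveCode (F : Linear.Fn) (l : Label) (c : Mach.Code) :
    Mach.findLabel l (saveCode F ++ c) = Mach.findLabel l c := by
  unfold saveCode
  induction saved F with
  | nil => rfl
  | cons r rs ih => exact ih

theorem findLabel_restoreCode (F : Linear.Fn) (l : Label) (c : Mach.Code) :
    Mach.findLabel l (restoreCode F ++ c) = Mach.findLabel l c := by
  unfold restoreCode
  induction saved F with
  | nil => rfl
  | cons r rs ih => exact ih

/-- Each label is translated to itself, and the code generated for other instructions, restoring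
sequences included, contains none. -/
theorem findLabel_flatMap {F : Linear.Fn} {l : Label} {c c' : Linear.Code}
    (h : Linear.findLabel l c = some c') :
    Mach.findLabel l (c.flatMap (transfInstr F)) = some (c'.flatMap (transfInstr F)) := by
  induction c with
  | nil => simp [Linear.findLabel] at h
  | cons i c ih =>
    rw [List.flatMap_cons]
    cases i with
    | label l' =>
      simp only [Linear.findLabel] at h
      simp only [transfInstr, List.cons_append, List.nil_append, Mach.findLabel]
      split_ifs at h ⊢ with hl
      · cases h; rfl
      · exact ih h
    | tailcall | ret =>
      simp only [transfInstr, List.append_assoc, findLabel_restoreCode]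
      exact ih h
    | getstack s | setstack _ s => cases s <;> exact ih h
    | _ => exact ih h

theorem findLabel_machFn {F : Linear.Fn} {l : Label} {c : Linear.Code}
    (h : Linear.findLabel l F.code = some c) :
    Mach.findLabel l (machFn F).code = some (c.flatMap (transfInstr F)) := by
  simp only [machFn, findLabel_saveCode, findLabel_flatMap h]

/-! ### Agreement between location maps and abstract frames -/

theorem BytesMeet.refl (τ : Typ) (δ : ℤ) : BytesMeet τ δ τ δ := by
  have := Typ.size_pos τ
  constructor <;> omega

theorem BytesMeet.symm {τ τ' : Typ} {δ δ' : ℤ} (h : BytesMeet τ δ τ' δ') :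
    BytesMeet τ' δ' τ δ := And.symm h

theorem frameEnv_set_same (Φ : Mach.FrameEnv) (τ : Typ) (δ : ℤ) (v : Val) :
    Φ.set τ δ v τ δ = v := if_pos ⟨rfl, rfl⟩

theorem frameEnv_set_of_bytesMeet (Φ : Mach.FrameEnv) {τ τ' : Typ} {δ δ' : ℤ} (v : Val)
    (hne : ¬ (τ = τ' ∧ δ = δ')) (h : BytesMeet τ δ τ' δ') : Φ.set τ δ v τ' δ' = .undef :=
  (if_neg hne).trans (if_pos h)

theorem frameEnv_set_of_not_bytesMeet (Φ : Mach.FrameEnv) {τ τ' : Typ} {δ δ' : ℤ} (v : Val)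
    (h : ¬ BytesMeet τ δ τ' δ') : Φ.set τ δ v τ' δ' = Φ τ' δ' := by
  refine (if_neg ?_).trans (if_neg h)
  rintro ⟨rfl, rfl⟩
  exact h (.refl τ δ)

/-- The abstract frame `Φ` and the location map `L` of an activation of `F` agree; `L₀` is the
location map of the caller. -/
structure FrameAgree (F : Linear.Fn) (L : LocMap) (Φ : Mach.FrameEnv) (L₀ : LocMap) : Prop where
  slot : ∀ s, InFrame F s → L (.slot s) = Φ s.typ (slotOfs F s)
  savedReg : ∀ r ∈ saved F, Φ r.typ (regOfs F r) = L₀ (.reg r)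
  unsavedReg : ∀ r : MReg, r.CalleeSave → r ∉ saved F → L (.reg r) = L₀ (.reg r)

/-- The words `w` are those of the outgoing area of the caller, as far as it has one. -/
def ParentAgree (w : Typ → ℕ → Val) : List Linear.Frame → List Mach.AltFrame → Prop
  | fr :: _, fr' :: _ => ∀ τ δ, δ + τ.words ≤ outgoingWords fr.fn →
      w τ δ = fr'.Φ τ (Mach.outgoingBase + 4 * δ)
  | _, _ => True

/-- The stack arguments lie in the outgoing area of the caller. -/
def ArgsFit (sig : Sig) (stk : List Linear.Frame) : Prop :=
  ∀ τ δ, Loc.slot (.outgoing τ δ) ∈ locArguments sig →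
    ∃ fr ∈ stk.head?, δ + τ.words ≤ outgoingWords fr.fn

/-- The condition on locations when a function is entered or has returned. -/
structure CallAgree (L : LocMap) (stk : List Linear.Frame) (stk' : List Mach.AltFrame) :
    Prop where
  reg : ∀ r : MReg, r.CalleeSave → L (.reg r) = parentLocs stk (.reg r)
  loc : ∀ τ δ, L (.slot (.localSlot τ δ)) = parentLocs stk (.slot (.localSlot τ δ))
  inc : ∀ τ δ, L (.slot (.incoming τ δ)) = parentLocs stk (.slot (.incoming τ δ))
  out : ParentAgree (fun τ δ => L (.slot (.outgoing τ δ))) stk stk'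

/-- A suspended activation satisfies what `StateMatch.regular` requires of the active one, except
for registers: those of Mach are global and no longer hold its values. -/
inductive StackMatch : List Linear.Frame → List Mach.AltFrame → Prop
  | nil : StackMatch [] []
  | cons {F σ c L Φ stk stk'} :
      Linear.WTFn F → c <:+ F.code → FrameAgree F L Φ (parentLocs stk) →
      ParentAgree (fun τ δ => L (.slot (.incoming τ δ))) stk stk' → ArgsFit F.sig stk →
      StackMatch stk stk' →
      StackMatch (⟨F, σ, c, L⟩ :: stk)
        (⟨machFn F, Mach.stackPtr (machFn F) σ, c.flatMap (transfInstr F), Φ⟩ :: stk')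

/-- A well-typed function definition and its translation. -/
def FunMatch (fd : FunDef Linear.Fn) (fd' : FunDef Mach.Fn) : Prop :=
  transfFunDef transfFn fd = some fd' ∧ ∀ F, fd = .internal F → Linear.WTFn F

/-- Matching states of Linear and of the alternate semantics of Mach. -/
inductive StateMatch : Linear.State → Mach.AltState → Prop
  | regular {F σ c L Φ stk stk' R M} :
      Linear.WTFn F → c <:+ F.code → FrameAgree F L Φ (parentLocs stk) →
      ParentAgree (fun τ δ => L (.slot (.incoming τ δ))) stk stk' → ArgsFit F.sig stk →
      StackMatch stk stk' → (∀ r, L (.reg r) = R r) →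
      StateMatch (.regular stk F σ c L M)
        (.regular stk' (machFn F) (.ptr σ (BitVec.ofInt 32 (machFn F).stackLow))
          (c.flatMap (transfInstr F)) R Φ M)
  | call {fd fd' L stk stk' R M} :
      FunMatch fd fd' → CallAgree L stk stk' → ArgsFit (Linear.funSig fd) stk →
      StackMatch stk stk' → (∀ r, L (.reg r) = R r) →
      StateMatch (.call stk fd L M) (.call stk' fd' R M)
  | ret {L stk stk' R M} :
      CallAgree L stk stk' → StackMatch stk stk' → (∀ r, L (.reg r) = R r) →
      StateMatch (.ret stk L M) (.ret stk' R M)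

/-- A register assigned by the code occurs in it; if callee-save it is therefore saved, and the
clause on unsaved registers does not concern it. -/
theorem FrameAgree.set_reg {F : Linear.Fn} {L L₀ : LocMap} {Φ : Mach.FrameEnv}
    (h : FrameAgree F L Φ L₀) {i : Linear.Instr} (hi : i ∈ F.code) {r : MReg}
    (hr : r ∈ regsOf i) (v : Val) : FrameAgree F (L.set (.reg r) v) Φ L₀ where
  slot s hs := by rw [LocMap.set_reg_slot]; exact h.slot s hs
  savedReg := h.savedReg
  unsavedReg r' hc hn := by
    rw [LocMap.set_reg, if_neg, h.unsavedReg r' hc hn]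
    rintro rfl
    exact hn (mem_saved.2 ⟨hc, List.mem_flatMap.2 ⟨i, hi, hr⟩⟩)

/-- The three cases of the update (same place, overlap, disjointness) correspond on the two sides,
and no save place meets a slot. -/
theorem FrameAgree.set_slot {F : Linear.Fn} {L L₀ : LocMap} {Φ : Mach.FrameEnv}
    (h : FrameAgree F L Φ L₀) {s : Slot} (hs : InFrame F s) (v : Val) :
    FrameAgree F (L.set (.slot s) v) (Φ.set s.typ (slotOfs F s) v) L₀ where
  slot s' hs' := by
    rw [LocMap.set_slot]
    split_ifs with e o
    · subst e; rw [frameEnv_set_same]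
    · rw [frameEnv_set_of_bytesMeet _ _ (fun e' => e (eq_of_slotOfs_eq hs hs' e'.1 e'.2))
        ((overlap_iff_bytesMeet hs hs').1 o)]
    · rw [frameEnv_set_of_not_bytesMeet _ _ (mt (overlap_iff_bytesMeet hs hs').2 o), h.slot s' hs']
  savedReg r hr := by
    rw [← h.savedReg r hr, frameEnv_set_of_not_bytesMeet _ _ (not_bytesMeet_slot_reg hs hr)]
  unsavedReg r hc hn := by rw [LocMap.set_slot_reg]; exact h.unsavedReg r hc hn

theorem ParentAgree.congr {w w' : Typ → ℕ → Val} {stk : List Linear.Frame}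
    {stk' : List Mach.AltFrame} (h : ParentAgree w stk stk') (hw : ∀ τ δ, w' τ δ = w τ δ) :
    ParentAgree w' stk stk' := by
  have : w' = w := funext₂ hw
  rwa [this]

/-- `exitfun` copies the incoming slots of the callee to the outgoing slots of the caller, so the
hypothesis on the former is the conclusion on the latter. -/
theorem callAgree_exitfun {L : LocMap} {stk : List Linear.Frame} {stk' : List Mach.AltFrame}
    (h : ParentAgree (fun τ δ => L (.slot (.incoming τ δ))) stk stk') :
    CallAgree (exitfun (parentLocs stk) L) stk stk' where
  reg _ hr := if_pos hr
  loc _ _ := rfl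
  inc _ _ := rfl
  out := h

theorem CallAgree.frameAgree {L : LocMap} {fr : Linear.Frame} {stk : List Linear.Frame}
    {fr' : Mach.AltFrame} {stk' : List Mach.AltFrame} (h : CallAgree L (fr :: stk) (fr' :: stk'))
    {L₀ : LocMap} (hf : FrameAgree fr.fn fr.locs fr'.Φ L₀) : FrameAgree fr.fn L fr'.Φ L₀ where
  slot s hs := by
    cases s with
    | localSlot τ δ => rw [h.loc]; exact hf.slot _ hs
    | incoming => exact hs.elim
    | outgoing τ δ => exact h.out τ δ hs
  savedReg := hf.savedReg
  unsavedReg r hc hn := by rw [h.reg r hc]; exact hf.unsavedReg r hc hn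

/-- Access to a stack argument in the frame of the caller. -/
theorem StackMatch.getParentFrame_eq {stk : List Linear.Frame} {stk' : List Mach.AltFrame}
    (h : StackMatch stk stk') {w : Typ → ℕ → Val} (hw : ParentAgree w stk stk') {sig : Sig}
    (ha : ArgsFit sig stk) {τ : Typ} {δ : ℕ}
    (hm : Loc.slot (.outgoing τ δ) ∈ locArguments sig) :
    Mach.getParentFrame stk' τ (Mach.outgoingBase + 4 * δ) = some (w τ δ) := by
  obtain ⟨fr, hfr, hle⟩ := ha τ δ hm
  cases h with
  | nil => simp at hfr
  | cons =>
    cases hfr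
    exact Mach.getFrame_eq_some.2 ⟨slotValid_slot (s := .outgoing τ δ) hle, (hw τ δ hle).symm⟩

/-! ### Saving and restoring callee-save registers -/

/-- The frame is constant throughout, so each register receives the content of its place whatever
the order of the restores. -/
theorem star_restore (Q : Program Mach.Fn) (F : Linear.Fn) (stk : List Mach.AltFrame) (σ : Val)
    (c : Mach.Code) (R : Mach.RegMap) (Φ : Mach.FrameEnv) (M : Mem) :
    (Mach.altSem Q).Star (.regular stk (machFn F) σ (restoreCode F ++ c) R Φ M) []
      (.regular stk (machFn F) σ c
        (fun r => if r ∈ saved F then Φ r.typ (regOfs F r) else R r) Φ M) := by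
  -- The list is decoupled from `saved F`, which fixes the layout and has to stay the same during
  -- the induction.
  suffices h : ∀ l : List MReg, (∀ r ∈ l, r ∈ saved F) → ∀ R,
      (Mach.altSem Q).Star (.regular stk (machFn F) σ
        (l.map (fun r => .getstack r.typ (regOfs F r) r) ++ c) R Φ M) []
        (.regular stk (machFn F) σ c
          (fun r => if r ∈ l then Φ r.typ (regOfs F r) else R r) Φ M) from
    h (saved F) (fun _ h => h) R
  intro l
  induction l with
  | nil =>
    intro _ R
    simpa using LTS.Star.refl (L := Mach.altSem Q) (.regular stk (machFn F) σ c R Φ M)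
  | cons r l ih =>
    intro hl R
    have hs : Mach.AltStep (globalenv Q) (.regular stk (machFn F) σ
        ((r :: l).map (fun r => .getstack r.typ (regOfs F r) r) ++ c) R Φ M) []
        (.regular stk (machFn F) σ (l.map (fun r => .getstack r.typ (regOfs F r) r) ++ c)
          (R.set r (Φ r.typ (regOfs F r))) Φ M) :=
      .getstack (Mach.getFrame_eq_some.2 ⟨slotValid_reg (hl r List.mem_cons_self), rfl⟩)
    have ht := ih (fun r' hr' => hl r' (List.mem_cons_of_mem _ hr')) (R.set r (Φ r.typ (regOfs F r)))
    have e : (fun r' => if r' ∈ l then Φ r'.typ (regOfs F r') else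
        (R.set r (Φ r.typ (regOfs F r))) r') =
        fun r' => if r' ∈ r :: l then Φ r'.typ (regOfs F r') else R r' := by
      funext r'
      by_cases h₁ : r' ∈ l
      · simp [h₁]
      · by_cases h₂ : r' = r
        · subst h₂; simp [Mach.RegMap.set]
        · simp [h₁, h₂, Mach.RegMap.set]
    rw [e] at ht
    exact LTS.Star.trans (L := Mach.altSem Q) hs ht

/-- The save places are pairwise disjoint and no register is saved twice, so later saves do not
damage earlier ones. The last clause shows that ordinary slots are still undefined after the
prologue. -/
theorem exists_star_save (Q : Program Mach.Fn) (F : Linear.Fn) (stk : List Mach.AltFrame)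
    (σ : Val) (c : Mach.Code) (R : Mach.RegMap) (Φ : Mach.FrameEnv) (M : Mem) :
    ∃ Φ' : Mach.FrameEnv,
      (Mach.altSem Q).Star (.regular stk (machFn F) σ (saveCode F ++ c) R Φ M) []
        (.regular stk (machFn F) σ c R Φ' M) ∧
      (∀ r ∈ saved F, Φ' r.typ (regOfs F r) = R r) ∧
      ∀ τ δ, (∀ r ∈ saved F, ¬ BytesMeet τ δ r.typ (regOfs F r)) → Φ' τ δ = Φ τ δ := by
  suffices h : ∀ l : List MReg, l.Nodup → (∀ r ∈ l, r ∈ saved F) → ∀ Φ : Mach.FrameEnv,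
      ∃ Φ' : Mach.FrameEnv,
        (Mach.altSem Q).Star (.regular stk (machFn F) σ
          (l.map (fun r => .setstack r r.typ (regOfs F r)) ++ c) R Φ M) []
          (.regular stk (machFn F) σ c R Φ' M) ∧
        (∀ r ∈ l, Φ' r.typ (regOfs F r) = R r) ∧
        ∀ τ δ, (∀ r ∈ l, ¬ BytesMeet τ δ r.typ (regOfs F r)) → Φ' τ δ = Φ τ δ from
    h (saved F) (nodup_saved F) (fun _ h => h) Φ
  intro l
  induction l with
  | nil => exact fun _ _ Φ => ⟨Φ, .refl _, by simp, fun _ _ _ => rfl⟩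
  | cons r l ih =>
    intro hn hl Φ
    obtain ⟨hrl, hn⟩ := List.nodup_cons.1 hn
    obtain ⟨hr, hl⟩ := List.forall_mem_cons.1 hl
    obtain ⟨Φ', hs, h₁, h₂⟩ := ih hn hl (Φ.set r.typ (regOfs F r) (R r))
    have hstep : Mach.AltStep (globalenv Q) (.regular stk (machFn F) σ
        ((r :: l).map (fun r => .setstack r r.typ (regOfs F r)) ++ c) R Φ M) []
        (.regular stk (machFn F) σ (l.map (fun r => .setstack r r.typ (regOfs F r)) ++ c) R
          (Φ.set r.typ (regOfs F r) (R r)) M) :=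
      .setstack (Mach.setFrame_eq_some.2 ⟨slotValid_reg hr, rfl⟩)
    refine ⟨Φ', LTS.Star.trans (L := Mach.altSem Q) hstep hs,
      List.forall_mem_cons.2 ⟨?_, h₁⟩, fun τ δ hd => ?_⟩
    · rw [h₂ _ _ fun r' hr' => not_bytesMeet_reg_reg hr (hl r' hr') ?_]
      · exact frameEnv_set_same ..
      · rintro rfl; exact hrl hr'
    · obtain ⟨hd₁, hd₂⟩ := List.forall_mem_cons.1 hd
      rw [h₂ τ δ hd₂, frameEnv_set_of_not_bytesMeet _ _ (mt BytesMeet.symm hd₁)]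

/-- The values of the registers after the callee-save registers have been restored. -/
theorem FrameAgree.regs_restore {F : Linear.Fn} {L L₀ : LocMap} {Φ : Mach.FrameEnv}
    {R : Mach.RegMap} (h : FrameAgree F L Φ L₀) (hR : ∀ r, L (.reg r) = R r) (r : MReg) :
    exitfun L₀ L (.reg r) = if r ∈ saved F then Φ r.typ (regOfs F r) else R r := by
  simp only [Linear.exitfun]
  split_ifs with h₁ h₂ h₂
  · exact (h.savedReg r h₂).symm
  · rw [← hR, h.unsavedReg r h₁ h₂]
  · exact absurd (mem_saved.1 h₂).1 h₁
  · exact hR r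

/-! ### The simulation -/

theorem FunMatch.of_findFunction {P : Program Linear.Fn} {Q : Program Mach.Fn}
    (hP : Linear.WTProgram P) (h : transf P = some Q) {rs rs' : MReg → Val} {f : FunRef}
    (hrs : ∀ r, f = .reg r → rs' r = rs r) {fd : FunDef Linear.Fn}
    (hfd : findFunction (globalenv P) rs f = some fd) :
    ∃ fd', findFunction (globalenv Q) rs' f = some fd' ∧ FunMatch fd fd' := by
  obtain ⟨fd', h₁, h₂⟩ := findFunction_transfProgram h hrs hfd
  refine ⟨fd', h₁, h₂, ?_⟩
  rintro F rfl
  obtain ⟨id, hid⟩ := mem_functs_of_findFunction hfd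
  exact hP id F hid

theorem FunMatch.funSig_eq {fd : FunDef Linear.Fn} {fd' : FunDef Mach.Fn} (h : FunMatch fd fd') :
    Mach.funSig fd' = Linear.funSig fd := by
  cases fd with
  | internal F =>
    obtain ⟨F', hF', rfl⟩ := Option.map_eq_some_iff.1 h.1
    obtain ⟨-, rfl⟩ := transfFn_eq_some.1 hF'
    rfl
  | external fe => cases h.1; rfl

theorem map_regs_eq {L : LocMap} {R : Mach.RegMap} (h : ∀ r, L (.reg r) = R r)
    (args : List MReg) : args.map L.regs = args.map R :=
  List.map_congr_left fun r _ => h r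

theorem regs_set {L : LocMap} {R : Mach.RegMap} (h : ∀ r, L (.reg r) = R r) (r : MReg) (v : Val)
    (r' : MReg) : L.set (.reg r) v (.reg r') = R.set r v r' := by
  rw [LocMap.set_reg]
  by_cases e : r = r'
  · subst e; simp [Mach.RegMap.set]
  · simp [Mach.RegMap.set, e, Ne.symm e, h]

/-- Most transitions are matched by a single one. Entry, return and tail call also run the saving or
restoring code, where the implicit treatment of callee-save registers in Linear becomes explicit. -/
theorem plus_of_step {P : Program Linear.Fn} {Q : Program Mach.Fn} (hP : Linear.WTProgram P)
    (h : transf P = some Q) {S₁ S₁' : Linear.State} {S₂ : Mach.AltState} {t : Trace}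
    (hm : StateMatch S₁ S₂) (hs : Linear.Step (globalenv P) S₁ t S₁') :
    ∃ S₂', (Mach.altSem Q).Plus S₂ t S₂' ∧ StateMatch S₁' S₂' := by
  have one : ∀ {S S' : Mach.AltState} {t : Trace}, Mach.AltStep (globalenv Q) S t S' →
      (Mach.altSem Q).Plus S t S' := fun h => LTS.Plus.one (L := Mach.altSem Q) h
  cases hm with
  | @regular F σ c L Φ stk stk' R M hwt hc hfr hpa haf hstk hR =>
    have htail : ∀ {i c'}, i :: c' = c → c' <:+ F.code ∧ i ∈ F.code := by
      rintro i c' rfl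
      exact ⟨(List.suffix_cons _ _).trans hc, hc.subset List.mem_cons_self⟩
    cases hs with
    | @getstack _ _ _ s r c =>
      obtain ⟨hc', hi⟩ := htail rfl
      have hfr' := hfr.set_reg hi (r := r) List.mem_cons_self (L (.slot s))
      -- The three kinds of slots use different instructions but lead to the same state, so only the
      -- transition is left to each case.
      have key : ∀ S, Mach.AltStep (globalenv Q)
          (.regular stk' (machFn F) (.ptr σ (BitVec.ofInt 32 (machFn F).stackLow))
            ((Linear.Instr.getstack s r :: c).flatMap (transfInstr F)) R Φ M) [] S →
          S = .regular stk' (machFn F) (.ptr σ (BitVec.ofInt 32 (machFn F).stackLow))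
            (c.flatMap (transfInstr F)) (R.set r (L (.slot s))) Φ M →
          ∃ S₂', (Mach.altSem Q).Plus
            (.regular stk' (machFn F) (.ptr σ (BitVec.ofInt 32 (machFn F).stackLow))
              ((Linear.Instr.getstack s r :: c).flatMap (transfInstr F)) R Φ M) [] S₂' ∧
            StateMatch (.regular stk F σ c (L.set (.reg r) (L (.slot s))) M) S₂' := by
        rintro S hS rfl
        exact ⟨_, one hS, .regular hwt hc' hfr' (hpa.congr fun _ _ => LocMap.set_reg_slot ..) haf
          hstk (regs_set hR r _)⟩
      cases s with
      | incoming τ δ =>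
        obtain ⟨-, hmem⟩ := hwt _ hi
        exact key _ (.getparent (hstk.getParentFrame_eq hpa haf
          (mem_locArguments_of_incoming hmem))) rfl
      | localSlot τ δ | outgoing τ δ =>
        have hin := inFrame_of_need hi ⟨r, .inl rfl⟩ (by simp)
        exact key _ (.getstack (Mach.getFrame_eq_some.2 ⟨slotValid_slot hin, rfl⟩))
          (by rw [hfr.slot _ hin]; rfl)
    | @setstack _ _ _ r s c =>
      obtain ⟨hc', hi⟩ := htail rfl
      have key : (∀ τ δ, s ≠ .incoming τ δ) →
          transfInstr F (.setstack r s) = [.setstack r s.typ (slotOfs F s)] →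
          ∃ S₂', (Mach.altSem Q).Plus
            (.regular stk' (machFn F) (.ptr σ (BitVec.ofInt 32 (machFn F).stackLow))
              ((Linear.Instr.setstack r s :: c).flatMap (transfInstr F)) R Φ M) [] S₂' ∧
            StateMatch (.regular stk F σ c (L.set (.slot s) (L (.reg r))) M) S₂' := by
        intro hs he
        have hin := inFrame_of_need hi ⟨r, .inr rfl⟩ hs
        rw [List.flatMap_cons, he]
        refine ⟨_, one (.setstack (Mach.setFrame_eq_some.2 ⟨slotValid_slot hin, rfl⟩)),
          .regular hwt hc' (hR r ▸ hfr.set_slot hin _) (hpa.congr fun τ δ => ?_) haf hstk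
            fun r' => (LocMap.set_slot_reg ..).trans (hR r')⟩
        -- Slots of different kinds never overlap, so incoming slots, and with them the agreement
        -- with the caller, are untouched.
        rw [LocMap.set_slot, if_neg (hs τ δ), if_neg]
        cases s <;> simp [Slot.Overlap] at hs ⊢
      cases s with
      | incoming => exact (hwt _ hi).2.elim
      | localSlot | outgoing => exact key (by simp) rfl
    | @op _ _ _ o args res c _ _ v hv =>
      obtain ⟨hc', hi⟩ := htail rfl
      rw [map_regs_eq hR] at hv
      exact ⟨_, one (.op (evalOp_transfOp h hv)), .regular hwt hc'
        (hfr.set_reg hi List.mem_cons_self v) (hpa.congr fun _ _ => LocMap.set_reg_slot ..) haf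
        hstk (regs_set hR _ _)⟩
    | @load _ _ _ κ m args dst c _ _ b δ v hv hl =>
      obtain ⟨hc', hi⟩ := htail rfl
      rw [map_regs_eq hR] at hv
      exact ⟨_, one (.load (evalMode_transfMode h hv) hl), .regular hwt hc'
        (hfr.set_reg hi List.mem_cons_self v) (hpa.congr fun _ _ => LocMap.set_reg_slot ..) haf
        hstk (regs_set hR _ _)⟩
    | store hv hl =>
      obtain ⟨hc', hi⟩ := htail rfl
      rw [map_regs_eq hR] at hv
      rw [hR] at hl
      exact ⟨_, one (.store (evalMode_transfMode h hv) hl),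
        .regular hwt hc' hfr hpa haf hstk hR⟩
    | @call _ _ _ sig f c _ _ fd hf hsig =>
      obtain ⟨hc', hi⟩ := htail rfl
      obtain ⟨fd', hf', hfm⟩ := FunMatch.of_findFunction hP h (rs' := R)
        (fun r _ => (hR r).symm) hf
      -- The callee's view of its arguments is the outgoing part of the caller's `FrameAgree`; they
      -- fit because the outgoing area is sized for every call in the code.
      refine ⟨_, one (.call hf' (hfm.funSig_eq.trans hsig)),
        .call hfm ⟨fun _ _ => rfl, fun _ _ => rfl, fun _ _ => rfl,
          fun τ δ hle => hfr.slot (.outgoing τ δ) hle⟩ (fun τ δ hm => ⟨_, rfl, ?_⟩)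
          (.cons hwt hc' hfr hpa haf hstk) hR⟩
      obtain ⟨_, _, he, hle⟩ := locArguments_slot hm
      cases he
      exact (hsig ▸ hle).trans (sizeArguments_le hi)
    | @tailcall _ _ _ sig f c _ _ fd hf hsig =>
      obtain ⟨hc', hi⟩ := htail rfl
      obtain ⟨-, hncs, hargs⟩ := hwt _ hi
      have hR' := hfr.regs_restore hR
      -- The function pointer is read after the restores, which do not touch its register since that
      -- is not callee-save.
      have hrs : ∀ r, f = .reg r →
          (if r ∈ saved F then Φ r.typ (regOfs F r) else R r) = LocMap.regs L r := by
        rintro r rfl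
        exact (if_neg fun hs => hncs (mem_saved.1 hs).1).trans (hR r).symm
      obtain ⟨fd', hf', hfm⟩ := FunMatch.of_findFunction hP h hrs hf
      rw [List.flatMap_cons, transfInstr, List.append_assoc]
      -- The stack arguments of the tail call are stack parameters of `F`, so they already lie in
      -- the outgoing area of its caller.
      exact ⟨_, LTS.Star.plus_of_step (star_restore Q F _ _ _ R Φ M)
        (Mach.AltStep.tailcall hf' (hfm.funSig_eq.trans hsig)),
        .call hfm (callAgree_exitfun hpa) (fun τ δ hm => haf τ δ (hargs _ (hsig ▸ hm))) hstk hR'⟩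
    | cond_true hv hl =>
      rw [map_regs_eq hR] at hv
      exact ⟨_, one (.cond_true hv (findLabel_machFn hl)),
        .regular hwt (Linear.findLabel_suffix hl) hfr hpa haf hstk hR⟩
    | cond_false hv =>
      rw [map_regs_eq hR] at hv
      exact ⟨_, one (.cond_false hv), .regular hwt (htail rfl).1 hfr hpa haf hstk hR⟩
    | goto hl =>
      exact ⟨_, one (.goto (findLabel_machFn hl)),
        .regular hwt (Linear.findLabel_suffix hl) hfr hpa haf hstk hR⟩
    | label =>
      exact ⟨_, one .label, .regular hwt (htail rfl).1 hfr hpa haf hstk hR⟩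
    | ret =>
      rw [List.flatMap_cons, transfInstr, List.append_assoc]
      exact ⟨_, LTS.Star.plus_of_step (star_restore Q F _ _ _ R Φ M) Mach.AltStep.ret,
        .ret (callAgree_exitfun hpa) hstk (hfr.regs_restore hR)⟩
  | @call fd fd' L stk stk' R M hfm hca haf hstk hR =>
    cases hs with
    | @internal _ F _ _ σ M' halloc =>
      obtain ⟨F', hF', rfl⟩ := Option.map_eq_some_iff.1 hfm.1
      obtain ⟨-, rfl⟩ := transfFn_eq_some.1 hF'
      obtain ⟨Φ', hsave, h₁, h₂⟩ := exists_star_save Q F stk' (Mach.stackPtr (machFn F) σ)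
        (F.code.flatMap (transfInstr F)) R Mach.undefFrame M'
      have hint : Mach.AltStep (globalenv Q) (.call stk' (.internal (machFn F)) R M) []
        (.regular stk' (machFn F) (Mach.stackPtr (machFn F) σ) (machFn F).code R
          Mach.undefFrame M') := .internal halloc
      refine ⟨_, LTS.Plus.intro (L := Mach.altSem Q) hint hsave,
        .regular (hfm.2 F rfl) List.suffix_rfl ⟨fun s hs => ?_, fun r hr => ?_, fun r hr _ => ?_⟩
          hca.out haf hstk hR⟩
      -- The saves leave the places of slots undefined, like the local and outgoing slots given by
      -- `entryfun`.
      · rw [h₂ _ _ fun r hr => not_bytesMeet_slot_reg hs hr]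
        cases s with
        | incoming => exact hs.elim
        | localSlot | outgoing => rfl
      -- The saved value is the one at entry, where callee-save registers still have the caller's
      -- values.
      · rw [h₁ r hr, ← hR, hca.reg r (mem_saved.1 hr).1]
      · exact hca.reg r hr
    | @external _ fe _ _ _ v hv =>
      cases hfm.1
      have hargs : (locArguments fe.sig).mapM (Mach.altExtArg R stk') =
          some ((locArguments fe.sig).map L) := by
        refine mapM_eq_some_map fun ℓ hℓ => ?_
        cases ℓ with
        | reg r => exact congrArg some (hR r).symm
        | slot s =>
          obtain ⟨τ, δ, rfl, -⟩ := locArguments_slot hℓ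
          exact hstk.getParentFrame_eq hca.out haf hℓ
      refine ⟨_, one (.external hargs hv), .ret ⟨fun r hr => ?_, fun τ δ => ?_, fun τ δ => ?_,
        hca.out.congr fun _ _ => LocMap.set_reg_slot ..⟩ hstk (regs_set hR _ _)⟩
      · rw [LocMap.set_reg, if_neg, hca.reg r hr]
        rintro rfl
        exact not_calleeSave_locResult _ hr
      · rw [LocMap.set_reg_slot, hca.loc]
      · rw [LocMap.set_reg_slot, hca.inc]
  | ret hca hstk hR =>
    cases hs with
    | resume =>
      cases hstk with
      | cons hwt hc hfr hpa haf hstk =>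
        exact ⟨_, one .resume, .regular hwt hc (hca.frameAgree hfr)
          (hpa.congr fun τ δ => hca.inc τ δ) haf hstk hR⟩

theorem exists_altInitial {P : Program Linear.Fn} {Q : Program Mach.Fn}
    (hP : Linear.WTProgram P) (h : transf P = some Q) {S₁ : Linear.State}
    (hS : Linear.Initial P S₁) : ∃ S₂, Mach.AltInitial Q S₂ ∧ StateMatch S₁ S₂ := by
  obtain ⟨hb, hfd, hsig⟩ := hS
  rename_i b fd
  obtain ⟨fd', hfd', ht⟩ := funct_transfProgram h hfd
  have hfm : FunMatch fd fd' := by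
    refine ⟨ht, ?_⟩
    rintro F rfl
    obtain ⟨id, hid⟩ := mem_functs_of_funct hfd
    exact hP id F hid
  refine ⟨.call [] fd' Mach.undefRegs (initmem Q), .intro ?_ hfd' (hfm.funSig_eq.trans hsig), ?_⟩
  · rw [← (transfProgram_eq_some h).2.1, ← symbol_transfProgram h, hb]
  · rw [initmem_transfProgram h]
    refine .call hfm ⟨fun _ _ => rfl, fun _ _ => rfl, fun _ _ => rfl, trivial⟩ ?_ .nil
      fun _ => rfl
    intro τ δ hm
    -- The entry point has no arguments, so there is nothing to fit although there is no caller.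
    rw [hsig] at hm
    cases hm

/-- The simulation must relate all pairs of initial states; uniqueness reduces this to the one pair
constructed above. -/
theorem altInitial_unique {Q : Program Mach.Fn} {S S' : Mach.AltState}
    (h : Mach.AltInitial Q S) (h' : Mach.AltInitial Q S') : S = S' := by
  obtain ⟨h₁, h₂, -⟩ := h
  obtain ⟨h₁', h₂', -⟩ := h'
  obtain rfl := Option.some.inj (h₁.symm.trans h₁')
  obtain rfl := Option.some.inj (h₂.symm.trans h₂')
  rfl

theorem plusSimulation_stateMatch {P : Program Linear.Fn} {Q : Program Mach.Fn}
    (hP : Linear.WTProgram P) (h : transf P = some Q) :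
    PlusSimulation (Linear.sem P) (Mach.altSem Q) StateMatch where
  initial_exists _ hS := let ⟨S₂, h₂, _⟩ := exists_altInitial hP h hS; ⟨S₂, h₂⟩
  initial S₁ S₂ h₁ h₂ := by
    obtain ⟨S₂', h₂', hm⟩ := exists_altInitial hP h h₁
    rwa [altInitial_unique h₂ h₂']
  final := by
    rintro S₁ S₂ n hm ⟨hn⟩
    cases hm with
    | ret _ hstk hR =>
      cases hstk
      exact .intro ((hR _).symm.trans hn)
  plus _ _ _ _ hm hs := plus_of_step hP h hm hs

theorem StateMatch.mem_eq_and_regs_eq {S₁ : Linear.State} {S₂ : Mach.AltState}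
    (h : StateMatch S₁ S₂) : S₁.mem = S₂.mem ∧ ∀ r, S₁.locs (.reg r) = S₂.regs r := by
  cases h with
  | regular _ _ _ _ _ _ h | call _ _ _ _ h | ret _ _ h => exact ⟨rfl, h⟩

end Stacking

/-- Semantic preservation. -/
theorem Stacking.behaves_of_behaves {retaddr : Mach.RetAddr} {P : Program Linear.Fn}
    {Q : Program Mach.Fn} (hP : Linear.WTProgram P) (h : Stacking.transf P = some Q)
    (hra : Mach.HasReturnAddresses retaddr Q) {B : Behavior} (hB : ¬ B.Wrong)
    (hb : (Linear.sem P).Behaves B) : (Mach.sem retaddr Q).Behaves B := by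
  have hQ := wtProgram_transf hP h
  have h₂ := (Mach.lockStepSimulationOn_stateMatch hQ hra).plusSimulation
    (fun _ => Mach.wtState_of_altInitial hQ) (fun _ _ _ => Mach.wtState_of_altStep hQ)
  exact h₂.behaves hB ((plusSimulation_stateMatch hP h).behaves hB hb)

end Compcert

open Compcert in
theorem mainTheorem7 (retaddr : Mach.RetAddr) :
    -- semantic preservation for the pass
    (∀ (P : Program Linear.Fn) (Q : Program Mach.Fn),
      Linear.WTProgram P → Stacking.transf P = some Q → Mach.HasReturnAddresses retaddr Q →
      ∀ B : Behavior, ¬ B.Wrong →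
        (Linear.sem P).Behaves B → (Mach.sem retaddr Q).Behaves B) ∧
    -- the compiled program is well typed, and a "plus" simulation relates the source program to
    -- the compiled program under the alternate semantics
    (∀ (P : Program Linear.Fn) (Q : Program Mach.Fn),
      Linear.WTProgram P → Stacking.transf P = some Q →
      Mach.WTProgram Q ∧
      ∃ R : Linear.State → Mach.AltState → Prop,
        PlusSimulation (Linear.sem P) (Mach.altSem Q) R ∧
        ∀ S₁ S₂, R S₁ S₂ → S₁.mem = S₂.mem ∧ ∀ r, S₁.locs (.reg r) = S₂.regs r) ∧
    -- subject reduction for the alternate semantics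
    (∀ Q : Program Mach.Fn, Mach.WTProgram Q →
      (∀ S, (Mach.altSem Q).initial S → Mach.WTState S) ∧
      ∀ S t S', (Mach.altSem Q).step S t S' → Mach.WTState S → Mach.WTState S') ∧
    -- lock-step simulation between the alternate and the standard semantics
    (∀ Q : Program Mach.Fn, Mach.WTProgram Q → Mach.HasReturnAddresses retaddr Q →
      ∃ R : Mach.AltState → Mach.State → Prop,
        LockStepSimulationOn (Mach.altSem Q) (Mach.sem retaddr Q) Mach.WTState R ∧
        ∀ S₁ S₂, R S₁ S₂ → S₁.regs = S₂.regs ∧ S₁.mem.Extends S₂.mem) := by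
  refine ⟨fun P Q hP h hra B hB hb => Stacking.behaves_of_behaves hP h hra hB hb,
    fun P Q hP h => ⟨Stacking.wtProgram_transf hP h, Stacking.StateMatch,
      Stacking.plusSimulation_stateMatch hP h, fun _ _ hR => hR.mem_eq_and_regs_eq⟩,
    fun Q hQ => ⟨fun _ => Mach.wtState_of_altInitial hQ,
      fun _ _ _ => Mach.wtState_of_altStep hQ⟩,
    fun Q hQ hra => ⟨Mach.StateMatch Q, Mach.lockStepSimulationOn_stateMatch hQ hra,
      fun _ _ hR => hR.regs_eq_and_extends⟩⟩
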